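/- Let $g\ge 1$ and let $z=(z_1,z_3,\dots,z_{2g-1})$ be coordinates on $\mathbb C^g$, $\partial_{k}=\partial/\partial z_{k}$, with the convention $\partial_k=0$ for $k>2g-1$. Let $\widehat H_0,\widehat H_2,\widehat H_4$ be the values at $\lambda=0$ of the genus-$g$ Schrödinger operators $H_0,H_2,H_4$ that define the heat equations of the hyperelliptic sigma function; explicitly $$\widehat H_0=\sum_{s=1}^{g}(2s-1)z_{2s-1}\partial_{2s-1}-\frac{g(g+1)}2,\qquad \widehat H_2=\frac12\,\partial_1^2+\sum_{s=1}^{g-1}(2s-1)z_{2s-1}\partial_{2s+1},$$ $$\widehat H_4=\partial_1\partial_3+\sum_{s=1}^{g-2}(2s-1)z_{2s-1}\partial_{2s+3}.$$ Universal Adler–Moser polynomials are polynomials $\theta_k(\tau_1,\dots,\tau_k)\in\mathbb C[\tau_1,\dots,\tau_k]$, $k=0,1,2,\dots$, such that, with $x=\tau_1$ and $'=\partial/\partial x$: * $\theta_0=1$, $\theta_1=x$ and $\theta_{k+1}'\theta_{k-1}-\theta_{k+1}\theta_{k-1}'=(2k+1)\theta_k^2$ for all $k\ge 1$; * they give the general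 solution of this system: every sequence of polynomials $\varphi_k\in\mathbb C[x]$ with $\varphi_0=1$, $\varphi_1=x$ that satisfies the same equations is of the form $\varphi_k(x)=\theta_k(x,t_2,\dots,t_k)$ for some constants $t_2,t_3,\ldots\in\mathbb C$; * $\theta_k=x^{k(k+1)/2}+\cdots$ for $k\ge 0$ and $\partial\theta_k/\partial\tau_k=x^{(k-2)(k-1)/2}+\cdots$ for $k\ge 2$, where the dots stand for terms of lower degree in $x$ (with coefficients polynomial in the other variables). **Theorem.** Universal Adler–Moser polynomials exist. Let $(\theta_k)_{k\ge0}$ be any family of universal Adler–Moser polynomials. Then for each $g\ge1$ there is an invertible polynomial change of variables $$\tau_1=z_1,\qquad \tau_k=b_k\,z_{2k-1}+h_k(z_3,\dots,z_{2k-3})\quad(2\le k\le g),$$ with constants $b_k\in\mathbb C\setminus\{0\}$ and polynomials $h_k$ over $\mathbb C$, such that a polynomial $\psi\in\mathbb C[z_1,z_3,\dots,z_{2g-1}]$ satisfies $\widehat H_0\psi=\widehat H_2\psi=\widehat H_4\psi=0$ if and only if $$\psi(z)=c\,\theta_g(\tau_1,\dots,\tau_g)$$ for some constant $c\in\mathbb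 C$. That is, any polynomial solution of the system coincides with the genus-$g$ Adler–Moser polynomial up to a multiplicative constant and a change of variables, and that polynomial is a solution. -/

import Mathlib

noncomputable section

namespace AdlerMoser

open MvPolynomial

/-- The coordinate `z_{2s-1}` on `ℂ^g`, whose coordinates are `z_1, z_3, …, z_{2g-1}`.
The coordinate `z_{2s-1}` is the variable of `MvPolynomial (Fin g) ℂ` with index `s - 1`.
It is set to `0` unless `1 ≤ s ≤ g`. -/
def z (g s : ℕ) : MvPolynomial (Fin g) ℂ :=
  if h : 1 ≤ s ∧ s ≤ g then X ⟨s - 1, by omega⟩ else 0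

/-- The derivation `∂_{2s-1} = ∂ / ∂ z_{2s-1}`, with `∂_{2s-1} = 0` unless `1 ≤ s ≤ g`. -/
def pd (g s : ℕ) : Derivation ℂ (MvPolynomial (Fin g) ℂ) (MvPolynomial (Fin g) ℂ) :=
  if h : 1 ≤ s ∧ s ≤ g then pderiv ⟨s - 1, by omega⟩ else 0

/-- The convention on the parameters `λ_4, λ_6, …, λ_{4g+2}` of the curve: `λ_0 = 1`, and
`λ_s = 0` for all `s` outside `{0, 4, 6, …, 4g, 4g+2}`. -/
def param (g : ℕ) (l : ℕ → ℂ) (s : ℕ) : ℂ :=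
  if s = 0 then 1 else if Even s ∧ 4 ≤ s ∧ s ≤ 4 * g + 2 then l s else 0

/-- The operator `H_0` of genus `g`. It does not involve the parameters. -/
def H0 (g : ℕ) (ψ : MvPolynomial (Fin g) ℂ) : MvPolynomial (Fin g) ℂ :=
  ∑ s ∈ Finset.Icc 1 g, C (2 * (s : ℂ) - 1) * z g s * pd g s ψ
    - C ((g : ℂ) * (g + 1) / 2) * ψ

/-- The operator `H_2` of genus `g` at the parameter value `l`. -/
def H2 (g : ℕ) (l : ℕ → ℂ) (ψ : MvPolynomial (Fin g) ℂ) : MvPolynomial (Fin g) ℂ :=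
  C (1 / 2) * pd g 1 (pd g 1 ψ)
    + ∑ s ∈ Finset.Icc 1 (g - 1), C (2 * (s : ℂ) - 1) * z g s * pd g (s + 1) ψ
    - C (4 / (2 * (g : ℂ) + 1) * param g l 4) *
        ∑ s ∈ Finset.Icc 1 (g - 1), C ((g : ℂ) - s) * z g (s + 1) * pd g s ψ
    + ∑ s ∈ Finset.Icc 1 g,
        C ((2 * (s : ℂ) - 1) / 2 * param g l (4 * s)
          - 2 * ((g : ℂ) - s + 1) / (2 * (g : ℂ) + 1) * param g l 4 * param g l (4 * s - 4))
          * z g s ^ 2 * ψ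

/-- The operator `H_4` of genus `g` at the parameter value `l`. -/
def H4 (g : ℕ) (l : ℕ → ℂ) (ψ : MvPolynomial (Fin g) ℂ) : MvPolynomial (Fin g) ℂ :=
  pd g 1 (pd g 2 ψ)
    + ∑ s ∈ Finset.Icc 1 (g - 2), C (2 * (s : ℂ) - 1) * z g s * pd g (s + 2) ψ
    + C (param g l 4) *
        ∑ s ∈ Finset.Icc 1 (g - 1), C (2 * (s : ℂ) - 1) * z g (s + 1) * pd g (s + 1) ψ
    - C (6 / (2 * (g : ℂ) + 1) * param g l 6) *
        ∑ s ∈ Finset.Icc 1 (g - 1), C ((g : ℂ) - s) * z g (s + 1) * pd g s ψ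
    + ∑ s ∈ Finset.Icc 1 g,
        C ((2 * (s : ℂ) - 1) * param g l (4 * s + 2)
          - 3 * ((g : ℂ) - s + 1) / (2 * (g : ℂ) + 1) * param g l 6 * param g l (4 * s - 4))
          * z g s ^ 2 * ψ
    + ∑ s ∈ Finset.Icc 1 (g - 1),
        C ((2 * (s : ℂ) - 1) * param g l (4 * s + 4)) * z g s * z g (s + 1) * ψ
    - C ((g : ℂ) * (g - 1) / 2 * param g l 4) * ψ

/-- The rational limit of `H_0`, that is, its value at `λ = 0`. -/
def Hhat0 (g : ℕ) (ψ : MvPolynomial (Fin g) ℂ) : MvPolynomial (Fin g) ℂ := H0 g ψ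

/-- The rational limit of `H_2`, that is, its value at `λ = 0`. -/
def Hhat2 (g : ℕ) (ψ : MvPolynomial (Fin g) ℂ) : MvPolynomial (Fin g) ℂ := H2 g 0 ψ

/-- The rational limit of `H_4`, that is, its value at `λ = 0`. -/
def Hhat4 (g : ℕ) (ψ : MvPolynomial (Fin g) ℂ) : MvPolynomial (Fin g) ℂ := H4 g 0 ψ

theorem param_zero (g s : ℕ) (hs : s ≠ 0) : param g 0 s = 0 := by
  simp [param, hs]

theorem Hhat0_eq (g : ℕ) (ψ : MvPolynomial (Fin g) ℂ) :
    Hhat0 g ψ = ∑ s ∈ Finset.Icc 1 g, C (2 * (s : ℂ) - 1) * z g s * pd g s ψ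
      - C ((g : ℂ) * (g + 1) / 2) * ψ := rfl

theorem Hhat2_eq (g : ℕ) (ψ : MvPolynomial (Fin g) ℂ) :
    Hhat2 g ψ = C (1 / 2) * pd g 1 (pd g 1 ψ)
      + ∑ s ∈ Finset.Icc 1 (g - 1), C (2 * (s : ℂ) - 1) * z g s * pd g (s + 1) ψ := by
  have h : ∀ s ∈ Finset.Icc 1 g,
      C ((2 * (s : ℂ) - 1) / 2 * param g 0 (4 * s)
          - 2 * ((g : ℂ) - s + 1) / (2 * (g : ℂ) + 1) * param g 0 4 * param g 0 (4 * s - 4))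
          * z g s ^ 2 * ψ = 0 := by
    intro s hs
    have := (Finset.mem_Icc.mp hs).1
    rw [param_zero g (4 * s) (by omega), param_zero g 4 (by omega)]
    simp
  rw [Hhat2, H2, Finset.sum_eq_zero h, param_zero g 4 (by omega)]
  simp

theorem Hhat4_eq (g : ℕ) (ψ : MvPolynomial (Fin g) ℂ) :
    Hhat4 g ψ = pd g 1 (pd g 2 ψ)
      + ∑ s ∈ Finset.Icc 1 (g - 2), C (2 * (s : ℂ) - 1) * z g s * pd g (s + 2) ψ := by
  have h : ∀ s ∈ Finset.Icc 1 g,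
      C ((2 * (s : ℂ) - 1) * param g 0 (4 * s + 2)
          - 3 * ((g : ℂ) - s + 1) / (2 * (g : ℂ) + 1) * param g 0 6 * param g 0 (4 * s - 4))
          * z g s ^ 2 * ψ = 0 := by
    intro s _
    rw [param_zero g (4 * s + 2) (by omega), param_zero g 6 (by omega)]
    simp
  have h' : ∀ s ∈ Finset.Icc 1 (g - 1),
      C ((2 * (s : ℂ) - 1) * param g 0 (4 * s + 4)) * z g s * z g (s + 1) * ψ = 0 := by
    intro s _
    rw [param_zero g (4 * s + 4) (by omega)]
    simp
  rw [Hhat4, H4, Finset.sum_eq_zero h, Finset.sum_eq_zero h', param_zero g 4 (by omega),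
    param_zero g 6 (by omega)]
  simp

/-- `p = x^n + …`, where `x` is the first variable and the dots stand for terms of degree
less than `n` in `x` (with coefficients that are polynomials in the other variables). -/
def HasLeadingPower {k : ℕ} (p : MvPolynomial (Fin (k + 1)) ℂ) (n : ℕ) : Prop :=
  ∀ m ∈ (p - X 0 ^ n).support, m 0 < n

/-- A sequence of polynomials `φ_k(x)` with `φ_0 = 1`, `φ_1 = x` and
`φ_{k+1}' φ_{k-1} - φ_{k+1} φ_{k-1}' = (2k+1) φ_k²` for all `k ≥ 1` (here `k = n + 1`). -/
structure IsAdlerMoserSequence (φ : ℕ → Polynomial ℂ) : Prop where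
  zero : φ 0 = 1
  one : φ 1 = Polynomial.X
  rec_eq : ∀ n : ℕ,
    Polynomial.derivative (φ (n + 2)) * φ n - φ (n + 2) * Polynomial.derivative (φ n)
      = Polynomial.C (2 * ((n : ℂ) + 1) + 1) * φ (n + 1) ^ 2

/-- The polynomial in `x` obtained from `p(τ_1, …, τ_k)` by `τ_1 = x` and `τ_i = t i` for
`2 ≤ i ≤ k`; the variable `τ_i` has index `i - 1`. -/
def specialize {k : ℕ} (t : ℕ → ℂ) (p : MvPolynomial (Fin k) ℂ) : Polynomial ℂ :=
  aeval (fun i : Fin k => if i.val = 0 then Polynomial.X else Polynomial.C (t (i.val + 1))) p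

/-- Universal Adler--Moser polynomials `θ_k(τ_1, …, τ_k)`, `k = 0, 1, 2, …`, in `k` independent
variables: in `x = τ_1` they give the general solution of the Adler--Moser equations, and
`θ_k = x^{k(k+1)/2} + …`, `∂θ_k/∂τ_k = x^{(k-2)(k-1)/2} + …`.
A polynomial in the first `n` variables is viewed as a polynomial in more variables by `rename`. -/
structure IsUniversalAdlerMoser (θ : (k : ℕ) → MvPolynomial (Fin k) ℂ) : Prop where
  zero : θ 0 = 1
  one : θ 1 = X 0
  rec_eq : ∀ n : ℕ,
    pderiv 0 (θ (n + 2)) * rename (Fin.castAdd 2) (θ n)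
        - θ (n + 2) * pderiv 0 (rename (Fin.castAdd 2) (θ n))
      = C (2 * ((n : ℂ) + 1) + 1) * rename Fin.castSucc (θ (n + 1)) ^ 2
  general : ∀ φ : ℕ → Polynomial ℂ, IsAdlerMoserSequence φ →
    ∃ t : ℕ → ℂ, ∀ k : ℕ, φ k = specialize t (θ k)
  leading : ∀ n : ℕ, HasLeadingPower (θ (n + 1)) ((n + 1) * (n + 2) / 2)
  leading_pderiv : ∀ n : ℕ,
    HasLeadingPower (pderiv (Fin.last (n + 1)) (θ (n + 2))) (n * (n + 1) / 2)

/-- An invertible polynomial change of variables of triangular form: `τ_1 = z_1` and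
`τ_k = b_k z_{2k-1} + h_k(z_3, …, z_{2k-3})`, `b_k ≠ 0`, for `2 ≤ k ≤ g`. Both `τ_k` and
`z_{2k-1}` have index `k - 1`. -/
structure IsChangeOfVariables {g : ℕ} (τ : Fin g → MvPolynomial (Fin g) ℂ) : Prop where
  first : ∀ i : Fin g, i.val = 0 → τ i = X i
  triangular : ∀ i : Fin g, 0 < i.val →
    ∃ (b : ℂ) (h : MvPolynomial (Fin g) ℂ), b ≠ 0 ∧
      (∀ j ∈ h.vars, 0 < j.val ∧ j.val < i.val) ∧ τ i = C b * X i + h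

end AdlerMoser

end

/-!
The solution of the system is the Schur polynomial of the staircase partition `(g, g - 1, …, 1)` in
the odd times `t_i = z_{2 i + 1}`, that is, the determinant `det (h_{2 j - i})` of size `g`, where
`∑ h_n λ^n = exp (∑ t_i λ^(2 i + 1))` (`tauDet`, and `amTau` when normalized to be monic). Since
`∂ h_n / ∂ t_i = h_{n - 2 i - 1}`, it is also the Wronskian of `h_1, h_3, …, h_{2 g - 1}` in
`x = t_0`. A determinant of the same shape with row indices `r` in place of `1, …, g` is `hDet`.

*Virasoro constraints.* `∂ / ∂ t_i` shifts the row indices one at a time by `2 i + 1`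
(`derivation_hDet`). A shift of the rows by an even number is a shift of the columns, and
contributes nothing (`sum_hDet_even_shift`). By Newton's recursion, the first-order part of
`H_2` or `H_4` acts on the determinant as a sum of even shifts weighted by the row indices
(`derivation_hDet_virasoro`), and the alternating property of the determinant turns the second-order
part into the opposite sum (`sum_hDet_stair_quadratic`). So the determinant solves the
system (`Hhat_amTau`).

*Adler–Moser equation.* The Desnanot–Jacobi identity, applied to the Wronskian matrix of
`h_1, h_3, …, h_{2 n + 3}, 1`, is the Adler–Moser equation for the determinants
(`hDet_wronskian`). The last time enters the determinant of size `k + 2` linearly, and its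
coefficient is, up to sign, the determinant of size `k` (`tauDet_update`).

*Universality.* If the Wronskian of `f` with a nonzero polynomial `φ` vanishes, then `f` is a
constant multiple of `φ`. So the Adler–Moser equation determines `φ_{k+2}` up to a multiple of
`φ_k`, and this is what the last time of the determinant adjusts. Hence the determinants in suitably
scaled times are universal (`isUniversalAdlerMoser_universalTheta`). The same argument over the ring
of polynomials in `z`, together with the leading power of `∂ θ_k / ∂ τ_k`, produces the
variables `τ_k` of any other universal family one by one (`IsPartialChange.exists_succ`).

*Uniqueness.* On the component of top degree of a solution, only the first-order parts of the
operators act. These are derivations, whose commutators give the derivations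
`∑ (2 s - 1) z_{2 s - 1} ∂_{2 (s + k) - 1}` for all `k ≥ 1`, a system that is triangular in
`∂_3, …, ∂_{2 g - 1}`. So the top component is a power of `z_1`, and a solution without the monomial
`z_1 ^ (g (g + 1) / 2)` is zero (`eq_zero_of_Hhat`).
-/

noncomputable section

/-! ### Determinants of shifted sequences and derivations -/

namespace AdlerMoser
open Finset Matrix

section Determinants

variable {A R : Type*} [CommRing A] [CommRing R] [Algebra A R]

theorem derivation_prod {ι : Type*} [DecidableEq ι] (δ : Derivation A R R) (s : Finset ι)
    (f : ι → R) : δ (∏ i ∈ s, f i) = ∑ k ∈ s, ∏ i ∈ s, if i = k then δ (f i) else f i := by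
  induction s using Finset.induction_on with
  | empty => simp
  | insert a s ha ih =>
    rw [Finset.prod_insert ha, Derivation.leibniz, ih, Finset.sum_insert ha, Finset.prod_insert ha]
    have h1 : (∏ i ∈ s, if i = a then δ (f i) else f i) = ∏ i ∈ s, f i :=
      Finset.prod_congr rfl fun i hi => if_neg fun (h : i = a) => ha (h ▸ hi)
    have h2 : ∀ k ∈ s, (∏ i ∈ insert a s, if i = k then δ (f i) else f i)
        = f a * ∏ i ∈ s, if i = k then δ (f i) else f i := fun k hk => by
      rw [Finset.prod_insert ha, if_neg fun (h : a = k) => ha (h ▸ hk)]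
    rw [h1, Finset.sum_congr rfl h2, ← Finset.mul_sum]
    simp only [if_true, smul_eq_mul]
    ring

variable {n : Type*} [Fintype n] [DecidableEq n]

theorem derivation_det_col (δ : Derivation A R R) (M : Matrix n n R) :
    δ M.det = ∑ k, (M.updateCol k fun i => δ (M i k)).det := by
  simp only [Matrix.det_apply, map_sum, Derivation.map_smul_of_tower, derivation_prod]
  rw [Finset.sum_comm]
  simp only [Finset.smul_sum]
  refine Finset.sum_congr rfl fun σ _ => ?_
  refine Finset.sum_congr rfl fun k _ => ?_
  congr 1
  refine Finset.prod_congr rfl fun i _ => ?_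
  by_cases h : i = k
  · subst h; simp
  · simp [h]

/-- The derivative of a determinant along a derivation, as a sum over the rows. -/
theorem derivation_det (δ : Derivation A R R) (M : Matrix n n R) :
    δ M.det = ∑ k, (M.updateRow k fun j => δ (M k j)).det := by
  rw [← Matrix.det_transpose, derivation_det_col]
  refine Finset.sum_congr rfl fun k _ => ?_
  rw [← Matrix.det_transpose (M.updateRow k _), ← Matrix.updateCol_transpose]
  rfl

/-- Both sides are the coefficient of `ε` in `det (M + ε N)`. -/
theorem sum_det_updateRow_eq_sum_det_updateCol (M N : Matrix n n R) :
    ∑ i, (M.updateRow i (N i)).det = ∑ j, (M.updateCol j fun i => N i j).det := by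
  have h1 : ∀ i, (M.updateRow i (N i)).det = ∑ j, M.adjugate j i * N i j := fun i => by
    rw [← Matrix.cramer_transpose_apply, Matrix.cramer_eq_adjugate_mulVec,
      ← Matrix.adjugate_transpose]
    rfl
  have h2 : ∀ j, (M.updateCol j fun i => N i j).det = ∑ i, M.adjugate j i * N i j := fun j => by
    rw [← Matrix.cramer_apply, Matrix.cramer_eq_adjugate_mulVec]
    rfl
  simp only [h1, h2]
  exact Finset.sum_comm

end Determinants

section ShiftedDeterminants

variable {A R : Type*} [CommRing A] [CommRing R] [Algebra A R] {g : ℕ}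

/-- The matrix with entries `H (2 j - r i)`, where the columns are numbered `j = 1, …, g`. -/
def hMatrix (H : ℤ → R) (r : Fin g → ℤ) : Matrix (Fin g) (Fin g) R :=
  Matrix.of fun i j => H (2 * ((j : ℤ) + 1) - r i)

/-- The determinant of the matrix with entries `H (2 j - r i)`. -/
def hDet (H : ℤ → R) (r : Fin g → ℤ) : R := (hMatrix H r).det

/-- The row indices `1, 2, …, g`. If `δ (H n) = H (n - 1)` for a derivation `δ`, then
`hDet H (stair g)` is the Wronskian of `H 1, H 3, …, H (2 g - 1)`. -/
def stair (g : ℕ) : Fin g → ℤ := fun i => (i : ℤ) + 1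

variable (H : ℤ → R) (r : Fin g → ℤ)

theorem hMatrix_add_single {R : Type*} (H : ℤ → R) (r : Fin g → ℤ) (i : Fin g) (m : ℤ) :
    hMatrix H (r + Pi.single i m)
      = (hMatrix H r).updateRow i fun j => H (2 * ((j : ℤ) + 1) - r i - m) := by
  ext k j
  by_cases h : k = i
  · subst h; simp [hMatrix, sub_sub]
  · simp [hMatrix, h]

theorem hDet_eq_zero {i l : Fin g} (hil : i ≠ l) (h : r i = r l) : hDet H r = 0 :=
  Matrix.det_zero_of_row_eq hil (by ext j; simp [hMatrix, h])

theorem hDet_comp_swap {i l : Fin g} (hil : i ≠ l) : hDet H (r ∘ Equiv.swap i l) = -hDet H r := by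
  have := Matrix.det_permute (Equiv.swap i l) (hMatrix H r)
  rw [Equiv.Perm.sign_swap hil] at this
  rw [hDet, hDet, show hMatrix H (r ∘ Equiv.swap i l)
    = (hMatrix H r).submatrix (Equiv.swap i l) id from rfl, this]
  simp

theorem derivation_hDet (δ : Derivation A R R) (m : ℤ) (hδ : ∀ n, δ (H n) = H (n - m)) :
    δ (hDet H r) = ∑ i, hDet H (r + Pi.single i m) := by
  simp only [hDet, hMatrix_add_single]
  rw [derivation_det]
  simp [hMatrix, hδ]

/-- A shift of all row indices by the same even number is a shift of the columns, so that the sum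
over the rows vanishes, even after the columns are weighted. -/
theorem sum_det_updateRow_even_shift (hH : ∀ n < 0, H n = 0) (hr : ∀ i, 1 ≤ r i) (m : ℕ)
    (hm : 1 ≤ m) (c : Fin g → R) :
    ∑ i, ((hMatrix H r).updateRow i
      fun j => c j * H (2 * ((j : ℤ) + 1) - r i - 2 * m)).det = 0 := by
  rw [sum_det_updateRow_eq_sum_det_updateCol _
    (fun i j => c j * H (2 * ((j : ℤ) + 1) - r i - 2 * m))]
  refine Finset.sum_eq_zero fun j _ => ?_
  have hs := Matrix.det_updateCol_smul (hMatrix H r) j (c j)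
    (fun i => H (2 * ((j : ℤ) + 1) - r i - 2 * m))
  simp only [Pi.smul_def, smul_eq_mul] at hs
  rw [hs]
  by_cases hj : (j : ℕ) < m
  · rw [Matrix.det_eq_zero_of_column_eq_zero j, mul_zero]
    intro i
    have := hr i
    rw [Matrix.updateCol_self]
    exact hH _ (by omega)
  · have hj' : (j : ℕ) - m < g := by omega
    rw [Matrix.det_zero_of_column_eq (i := j) (j := ⟨j - m, hj'⟩), mul_zero]
    · intro h
      have := congrArg Fin.val h
      simp only at this
      omega
    · intro i
      rw [Matrix.updateCol_self, Matrix.updateCol_ne (by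
        intro h
        have := congrArg Fin.val h
        simp only at this
        omega)]
      simp only [hMatrix, Matrix.of_apply]
      congr 1
      push_cast [Nat.cast_sub (not_lt.mp hj)]
      ring

theorem sum_hDet_even_shift (hH : ∀ n < 0, H n = 0) (hr : ∀ i, 1 ≤ r i) (m : ℕ) (hm : 1 ≤ m) :
    ∑ i, hDet H (r + Pi.single i (2 * m : ℤ)) = 0 := by
  have := sum_det_updateRow_even_shift H r hH hr m hm 1
  simpa [hDet, hMatrix_add_single] using this

/-- The action of the first-order part of the Virasoro operators. -/
theorem derivation_hDet_virasoro (hH : ∀ n < 0, H n = 0) (hr : ∀ i, 1 ≤ r i) (m : ℕ) (hm : 1 ≤ m)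
    (δ : Derivation A R R)
    (hδ : ∀ n : ℤ, n < 2 * g → δ (H n) = ((n - 2 * m : ℤ) : R) * H (n - 2 * m)) :
    δ (hDet H r) = -∑ i, (r i : R) * hDet H (r + Pi.single i (2 * m : ℤ)) := by
  have h0 := sum_det_updateRow_even_shift H r hH hr m hm
    (fun j => ((2 * ((j : ℤ) + 1) - 2 * m : ℤ) : R))
  rw [hDet, derivation_det, ← zero_sub, ← h0, ← Finset.sum_sub_distrib]
  refine Finset.sum_congr rfl fun i _ => ?_
  rw [hDet, hMatrix_add_single, ← Matrix.det_updateRow_smul, eq_sub_iff_add_eq,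
    ← Matrix.det_updateRow_add]
  congr 2
  ext j
  have hlt : 2 * ((j : ℤ) + 1) - r i < 2 * g := by
    have := hr i
    omega
  simp only [hMatrix, Matrix.of_apply, hδ _ hlt, Pi.add_apply, Pi.smul_apply, smul_eq_mul]
  push_cast
  ring

/-- Euler's identity: `H n` has weight `n`, so that the determinant is homogeneous. -/
theorem derivation_hDet_euler (δ : Derivation A R R) (hδ : ∀ n : ℤ, δ (H n) = (n : R) * H n) :
    δ (hDet H r) = ((∑ j : Fin g, 2 * ((j : ℤ) + 1) - ∑ i, r i : ℤ) : R) * hDet H r := by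
  have h0 := sum_det_updateRow_eq_sum_det_updateCol (hMatrix H r)
    (fun i j => ((2 * ((j : ℤ) + 1) : ℤ) : R) * hMatrix H r i j)
  have h1 : ∀ j, ((hMatrix H r).updateCol j
      fun i => ((2 * ((j : ℤ) + 1) : ℤ) : R) * hMatrix H r i j).det
      = ((2 * ((j : ℤ) + 1) : ℤ) : R) * hDet H r := fun j => by
    have := Matrix.det_updateCol_smul (hMatrix H r) j ((2 * ((j : ℤ) + 1) : ℤ) : R)
      (fun i => hMatrix H r i j)
    simp only [Pi.smul_def, smul_eq_mul] at this
    rw [this, hDet]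
    congr 2
    ext i k
    by_cases h : k = j
    · subst h; simp
    · simp [h]
  rw [Finset.sum_congr rfl fun j _ => h1 j] at h0
  rw [hDet, derivation_det, Int.cast_sub, Int.cast_sum, Int.cast_sum, sub_mul, Finset.sum_mul,
    Finset.sum_mul]
  change _ = ∑ j : Fin g, _ * hDet H r - _
  rw [← h0, ← Finset.sum_sub_distrib]
  refine Finset.sum_congr rfl fun i _ => ?_
  have h2 : (hMatrix H r).det = ((hMatrix H r).updateRow i (hMatrix H r i)).det := by
    rw [Matrix.updateRow_eq_self]
  rw [h2, ← Matrix.det_updateRow_smul, eq_sub_iff_add_eq, ← Matrix.det_updateRow_add]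
  congr 2
  ext j
  simp only [hMatrix, Matrix.of_apply, hδ, Pi.add_apply, Pi.smul_apply, smul_eq_mul]
  push_cast
  ring

theorem hDet_stair_add_single_last (k : ℕ) (i : Fin (k + 1)) (hi : i ≠ Fin.last k) :
    hDet H (stair (k + 1) + Pi.single i 1) = 0 := by
  have hlt : (i : ℕ) < k := by
    have := Fin.val_lt_last hi
    simpa using this
  refine hDet_eq_zero H _ (i := i) (l := ⟨i + 1, by omega⟩) ?_ ?_
  · intro h
    have := congrArg Fin.val h
    simp only at this
    omega
  · have h : (⟨i + 1, by omega⟩ : Fin (k + 1)) ≠ i := by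
      intro h
      have := congrArg Fin.val h
      simp only at this
      omega
    simp [stair, h]

/-- Differentiating the Wronskian differentiates its last row. -/
theorem derivation_hDet_stair (δ : Derivation A R R) (hδ : ∀ n, δ (H n) = H (n - 1)) (k : ℕ) :
    δ (hDet H (stair (k + 1))) = hDet H (stair (k + 1) + Pi.single (Fin.last k) 1) := by
  rw [derivation_hDet H _ δ 1 hδ]
  exact Finset.sum_eq_single _ (fun i _ hi => hDet_stair_add_single_last H k i hi) (by simp)

/-- The Vandermonde-type identity behind the Virasoro constraints: the terms with
`1 ≤ a < l - i` repeat a row index, and the others cancel in pairs. -/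
theorem sum_hDet_stair_pair [CharZero R] [IsDomain R] {i l : Fin g} (hil : i < l) (N : ℕ) :
    ∑ a ∈ Finset.range (N + 1),
        hDet H (stair g + Pi.single i (a : ℤ) + Pi.single l ((N : ℤ) - a))
      = hDet H (stair g + Pi.single l (N : ℤ)) := by
  have hne : i ≠ l := hil.ne
  have hlt : (i : ℕ) < l := hil
  obtain ⟨d, hd⟩ : ∃ d : ℕ, (l : ℕ) = i + d + 1 := ⟨l - i - 1, by omega⟩
  set F : ℕ → R := fun a => hDet H (stair g + Pi.single i (a : ℤ) + Pi.single l ((N : ℤ) - a))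
    with hF
  rw [Finset.sum_range_succ']
  have h0 : ∀ a < N, a + 1 < d + 1 → F (a + 1) = 0 := by
    intro a _ had
    have hl := l.2
    have hm : (⟨i + (a + 1), by omega⟩ : Fin g) ≠ i := by
      intro h; have := congrArg Fin.val h; simp only at this; omega
    have hm' : (⟨i + (a + 1), by omega⟩ : Fin g) ≠ l := by
      intro h; have := congrArg Fin.val h; simp only at this; omega
    refine hDet_eq_zero H _ hm.symm ?_
    simp [stair, hm, hm', hne]
    ring
  have hanti : ∀ a b : ℕ, a + b = d + 1 + N → F b = -F a := by
    intro a b hab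
    change hDet H _ = -hDet H _
    rw [← hDet_comp_swap H _ hne]
    refine congrArg (hDet H) (funext fun k => ?_)
    simp only [Function.comp, Pi.add_apply]
    by_cases hki : k = i
    · subst hki
      simp [hne, hne.symm, stair]
      omega
    by_cases hkl : k = l
    · subst hkl
      simp [hne, hne.symm, stair]
      omega
    · simp [Equiv.swap_apply_of_ne_of_ne hki hkl, hki, hkl]
  have hsum : ∑ a ∈ Finset.range N, F (a + 1) = 0 := by
    have h2 : ∑ a ∈ Finset.range N, F (a + 1) = ∑ a ∈ Finset.Ico d N, F (a + 1) := by
      refine (Finset.sum_subset (fun a ha => ?_) fun a ha ha' => ?_).symm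
      · simp only [Finset.mem_Ico, Finset.mem_range] at *; omega
      · simp only [Finset.mem_Ico, Finset.mem_range] at *
        exact h0 a ha (by omega)
    have h3 : ∑ a ∈ Finset.Ico d N, F (a + 1) = -∑ a ∈ Finset.Ico d N, F (a + 1) := by
      rw [← Finset.sum_neg_distrib]
      refine Finset.sum_nbij' (fun a => d + N - 1 - a) (fun a => d + N - 1 - a) ?_ ?_ ?_ ?_ ?_
      · intro a ha; simp only [Finset.mem_Ico] at *; omega
      · intro a ha; simp only [Finset.mem_Ico] at *; omega
      · intro a ha; simp only [Finset.mem_Ico] at *; omega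
      · intro a ha; simp only [Finset.mem_Ico] at *; omega
      · intro a ha
        simp only [Finset.mem_Ico] at ha
        exact hanti _ _ (by omega)
    rw [h2]
    exact CharZero.eq_neg_self_iff.mp h3
  change ∑ a ∈ Finset.range N, F (a + 1) + F 0 = _
  rw [hsum, zero_add]
  change hDet H _ = _
  simp

end ShiftedDeterminants
end AdlerMoser

/-! ### Virasoro constraints and the Desnanot–Jacobi identity -/

namespace AdlerMoser
open Finset Matrix

section Virasoro

variable {A R : Type*} [CommRing A] [CommRing R] [Algebra A R] {g : ℕ}
variable (H : ℤ → R)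

/-- The sum over all pairs of rows and all distributions of the shift `N` between them. For even `N`
the terms with even `a` and the last sum on the right vanish, and the terms with odd `a`
form the second-order part of a Virasoro operator. -/
theorem sum_hDet_stair_quadratic [CharZero R] [IsDomain R] (N : ℕ) :
    ∑ a ∈ Finset.range (N + 1), ∑ i, ∑ l,
        hDet H (stair g + Pi.single i (a : ℤ) + Pi.single l ((N : ℤ) - a))
      = 2 * ∑ l : Fin g, (l : R) * hDet H (stair g + Pi.single l (N : ℤ))
        + (N + 1) * ∑ l, hDet H (stair g + Pi.single l (N : ℤ)) := by
  set E : Fin g → R := fun l => hDet H (stair g + Pi.single l (N : ℤ)) with hE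
  have hG : ∀ i l : Fin g, ∑ a ∈ Finset.range (N + 1),
      hDet H (stair g + Pi.single i (a : ℤ) + Pi.single l ((N : ℤ) - a))
      = (if i < l then E l else 0) + (if l < i then E i else 0)
        + (if l = i then (N + 1) * E i else 0) := by
    intro i l
    rcases lt_trichotomy i l with h | h | h
    · rw [sum_hDet_stair_pair H h]
      simp [h, h.ne', h.not_gt, hE]
    · subst h
      simp [add_assoc, ← Pi.single_add, hE]
    · rw [← Finset.sum_range_reflect]
      have h' := sum_hDet_stair_pair H h N
      rw [show E i = hDet H (stair g + Pi.single i (N : ℤ)) from rfl, ← h']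
      simp only [h, h.ne, h.not_gt, if_true, if_false, zero_add, add_zero]
      refine Finset.sum_congr rfl fun a ha => ?_
      have ha' : a ≤ N := by simpa [Nat.lt_succ_iff] using ha
      rw [add_right_comm]
      congr 4
      · rw [Nat.add_sub_cancel, Nat.cast_sub ha']; ring
      · rw [Nat.add_sub_cancel, Nat.cast_sub ha']
  have hcount : ∀ l : Fin g, ∑ i : Fin g, (if i < l then E l else 0) = (l : R) * E l := by
    intro l
    rw [← Finset.sum_filter, Finset.sum_const, nsmul_eq_mul, ← Fin.card_Iio l]
    congr 2
    congr 1
    ext i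
    simp
  rw [Finset.sum_comm]
  simp_rw [Finset.sum_comm (s := Finset.range (N + 1)), hG, Finset.sum_add_distrib]
  rw [Finset.sum_comm]
  simp_rw [hcount, Finset.sum_ite_eq' Finset.univ]
  simp only [Finset.mem_univ, if_true, Finset.mul_sum]
  rw [← Finset.sum_add_distrib, ← Finset.sum_add_distrib, ← Finset.sum_add_distrib]
  exact Finset.sum_congr rfl fun i _ => by ring

theorem one_le_stair (i : Fin g) : 1 ≤ stair g i := by simp [stair]

theorem one_le_stair_add_single (i l : Fin g) (a : ℤ) (ha : 0 ≤ a) :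
    1 ≤ (stair g + Pi.single l a : Fin g → ℤ) i := by
  have h1 := one_le_stair i
  have h2 : 0 ≤ (Pi.single l a : Fin g → ℤ) i := by
    by_cases h : i = l
    · subst h; simpa using ha
    · simp [h]
  simp only [Pi.add_apply]
  omega

variable (hH : ∀ n < 0, H n = 0)
include hH

theorem sum_sum_hDet_stair_even (a b : ℕ) (hb : 1 ≤ b) :
    ∑ i : Fin g, ∑ l, hDet H (stair g + Pi.single i (a : ℤ) + Pi.single l (2 * b : ℤ)) = 0 :=
  Finset.sum_eq_zero fun i _ => sum_hDet_even_shift H _ hH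
    (fun j => one_le_stair_add_single j i a (by positivity)) b hb

/-- By `sum_hDet_even_shift`, the weights `l + 1` of the rows may be replaced by `l`. -/
theorem derivation_hDet_stair_virasoro (m : ℕ) (hm : 1 ≤ m) (δ : Derivation A R R)
    (hδ : ∀ n : ℤ, n < 2 * g → δ (H n) = ((n - 2 * m : ℤ) : R) * H (n - 2 * m)) :
    δ (hDet H (stair g)) = -∑ l : Fin g, (l : R) * hDet H (stair g + Pi.single l (2 * m : ℤ)) := by
  rw [derivation_hDet_virasoro H _ hH one_le_stair m hm δ hδ]
  have h0 := sum_hDet_even_shift H (stair g) hH one_le_stair m hm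
  rw [neg_inj, ← sub_eq_zero, ← Finset.sum_sub_distrib, ← h0]
  refine Finset.sum_congr rfl fun i _ => ?_
  simp only [stair]
  push_cast
  ring

variable [CharZero R] [IsDomain R]

/-- The first Virasoro constraint. -/
theorem hDet_stair_virasoro_one (δ₁ A₁ : Derivation A R R) (h1 : ∀ n, δ₁ (H n) = H (n - 1))
    (hA : ∀ n : ℤ, n < 2 * g → A₁ (H n) = ((n - 2 : ℤ) : R) * H (n - 2)) :
    δ₁ (δ₁ (hDet H (stair g))) + 2 * A₁ (hDet H (stair g)) = 0 := by
  have hq := sum_hDet_stair_quadratic (g := g) H 2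
  have h0 := sum_hDet_even_shift H (stair g) hH one_le_stair 1 le_rfl
  have hA' := derivation_hDet_stair_virasoro (g := g) H hH 1 le_rfl A₁ (by simpa using hA)
  simp only [Finset.sum_range_succ, Finset.sum_range_zero, zero_add] at hq
  have hQ2 : ∑ i : Fin g, ∑ l, hDet H (stair g + Pi.single i ((2 : ℕ) : ℤ)
      + Pi.single l (((2 : ℕ) : ℤ) - (2 : ℕ))) = 0 := by
    rw [Finset.sum_comm]
    refine Finset.sum_eq_zero fun l _ => ?_
    simpa using h0
  rw [hQ2] at hq
  norm_num at hq hA' h0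
  rw [h0] at hq
  have hdd : δ₁ (δ₁ (hDet H (stair g)))
      = ∑ i : Fin g, ∑ l, hDet H (stair g + Pi.single i 1 + Pi.single l 1) := by
    rw [derivation_hDet H _ δ₁ 1 h1, map_sum]
    exact Finset.sum_congr rfl fun i _ => derivation_hDet H _ δ₁ 1 h1
  rw [hdd, hA']
  linear_combination hq

/-- The second Virasoro constraint. -/
theorem hDet_stair_virasoro_two (δ₁ δ₃ A₂ : Derivation A R R) (h1 : ∀ n, δ₁ (H n) = H (n - 1))
    (h3 : ∀ n, δ₃ (H n) = H (n - 3))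
    (hA : ∀ n : ℤ, n < 2 * g → A₂ (H n) = ((n - 4 : ℤ) : R) * H (n - 4)) :
    δ₁ (δ₃ (hDet H (stair g))) + A₂ (hDet H (stair g)) = 0 := by
  have hq := sum_hDet_stair_quadratic (g := g) H 4
  have h0 := sum_hDet_even_shift H (stair g) hH one_le_stair 2 (by norm_num)
  have hQ2 := sum_sum_hDet_stair_even (g := g) H hH 2 1 le_rfl
  have hA' := derivation_hDet_stair_virasoro (g := g) H hH 2 (by norm_num) A₂ (by
    intro n hn; rw [hA n hn]; norm_num)
  simp only [Finset.sum_range_succ, Finset.sum_range_zero, zero_add] at hq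
  have hQ4 : ∑ i : Fin g, ∑ l, hDet H (stair g + Pi.single i ((4 : ℕ) : ℤ)
      + Pi.single l (((4 : ℕ) : ℤ) - (4 : ℕ))) = 0 := by
    rw [Finset.sum_comm]
    refine Finset.sum_eq_zero fun l _ => ?_
    simpa using h0
  have hQ1 : ∑ i : Fin g, ∑ l, hDet H (stair g + Pi.single i ((1 : ℕ) : ℤ)
      + Pi.single l (((4 : ℕ) : ℤ) - (1 : ℕ)))
      = ∑ i : Fin g, ∑ l, hDet H (stair g + Pi.single i ((3 : ℕ) : ℤ)
      + Pi.single l (((4 : ℕ) : ℤ) - (3 : ℕ))) := by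
    rw [Finset.sum_comm]
    refine Finset.sum_congr rfl fun i _ => Finset.sum_congr rfl fun l _ => ?_
    rw [add_right_comm]
    norm_num
  rw [hQ4, hQ1] at hq
  norm_num at hq hA' h0 hQ2
  rw [h0, hQ2] at hq
  have hdd : δ₁ (δ₃ (hDet H (stair g)))
      = ∑ i : Fin g, ∑ l, hDet H (stair g + Pi.single i 3 + Pi.single l 1) := by
    rw [derivation_hDet H _ δ₃ 3 h3, map_sum]
    exact Finset.sum_congr rfl fun i _ => derivation_hDet H _ δ₁ 1 h1
  rw [hdd, hA']
  have h2 : (2 : R) ≠ 0 := two_ne_zero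
  apply mul_left_cancel₀ h2
  linear_combination hq

end Virasoro

section DesnanotJacobi

theorem det_mul_det_fromBlocks_field {K m : Type*} [Field K] [Fintype m] [DecidableEq m]
    (A : Matrix m m K) (hA : A.det ≠ 0) (B : Matrix m (Fin 2) K) (C : Matrix (Fin 2) m K)
    (E : Matrix (Fin 2) (Fin 2) K) (minor : Fin 2 → Fin 2 → K)
    (hminor : ∀ a b, minor a b = (Matrix.fromBlocks A (B.submatrix id fun _ : Fin 1 => b)
      (C.submatrix (fun _ : Fin 1 => a) id) (E.submatrix (fun _ => a) fun _ => b)).det) :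
    A.det * (Matrix.fromBlocks A B C E).det
      = minor 0 0 * minor 1 1 - minor 0 1 * minor 1 0 := by
  let := A.invertibleOfIsUnitDet hA.isUnit
  have h : ∀ a b, minor a b = A.det * (E - C * ⅟A * B) a b := fun a b => by
    rw [hminor, Matrix.det_fromBlocks₁₁, Matrix.det_fin_one]
    rfl
  rw [Matrix.det_fromBlocks₁₁, Matrix.det_fin_two]
  simp only [h]
  ring

/-- The Desnanot–Jacobi identity for the last two rows and columns of a matrix over a domain.
The general identity does not need the hypothesis `hA`. -/
theorem desnanot_jacobi {R : Type*} [CommRing R] [IsDomain R] {k : ℕ}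
    (M : Matrix (Fin (k + 2)) (Fin (k + 2)) R) (s : Fin 2 → Fin (k + 1) → Fin (k + 2))
    (hs : s = ![Fin.castSucc, (Fin.last k).castSucc.succAbove])
    (hA : (M.submatrix (Fin.castAdd 2) (Fin.castAdd 2)).det ≠ 0) :
    (M.submatrix (Fin.castAdd 2) (Fin.castAdd 2)).det * M.det
      = (M.submatrix (s 0) (s 0)).det * (M.submatrix (s 1) (s 1)).det
        - (M.submatrix (s 0) (s 1)).det * (M.submatrix (s 1) (s 0)).det := by
  have hinj := IsFractionRing.injective R (FractionRing R)
  apply hinj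
  simp only [map_mul, map_sub, RingHom.map_det]
  set f := algebraMap R (FractionRing R)
  have hs1 : ∀ a i, s a (Fin.castAdd 1 i) = Fin.castAdd 2 i := by
    intro a i
    subst hs
    fin_cases a
    · rfl
    · ext
      have : (Fin.castAdd 1 i).castSucc < (Fin.last k).castSucc := by
        simp [Fin.lt_def]
      simp [Fin.succAbove_of_castSucc_lt _ _ this]
  have hs2 : ∀ a i, s a (Fin.natAdd k i) = Fin.natAdd k a := by
    intro a i
    subst hs
    fin_cases i
    fin_cases a
    · rfl
    · ext
      have : (Fin.last k).castSucc ≤ (Fin.natAdd k (0 : Fin 1)).castSucc := by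
        simp [Fin.le_def]
      simp [Fin.succAbove_of_le_castSucc _ _ this]
  have key := det_mul_det_fromBlocks_field
    (f.mapMatrix (M.submatrix (Fin.castAdd 2) (Fin.castAdd 2)))
    (by rw [← RingHom.map_det]; exact fun h => hA (hinj (by rw [h, map_zero])))
    (f.mapMatrix M |>.submatrix (Fin.castAdd 2) (Fin.natAdd k))
    (f.mapMatrix M |>.submatrix (Fin.natAdd k) (Fin.castAdd 2))
    (f.mapMatrix M |>.submatrix (Fin.natAdd k) (Fin.natAdd k))
    (fun a b => (f.mapMatrix (M.submatrix (s a) (s b))).det) (by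
      intro a b
      rw [← Matrix.det_submatrix_equiv_self (finSumFinEquiv (m := k) (n := 1))]
      congr 1
      ext (i | i) (j | j) <;> simp [hs1, hs2])
  rw [← key]
  congr 1
  rw [← Matrix.det_submatrix_equiv_self (finSumFinEquiv (m := k) (n := 2))]
  congr 1
  ext (i | i) (j | j) <;> simp

end DesnanotJacobi
end AdlerMoser

/-! ### The Adler–Moser equation for Wronskians -/

namespace AdlerMoser
open Finset Matrix

section Wronskian

variable {A R : Type*} [CommRing A] [CommRing R] [Algebra A R]
variable (H : ℤ → R)

/-- The matrix with entries `H (2 j - r i)` in all columns but the last, which is the first unit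
vector: the column of the function `1` and its derivatives. -/
def hMatrixAug {k : ℕ} (r : Fin (k + 1) → ℤ) : Matrix (Fin (k + 1)) (Fin (k + 1)) R :=
  Matrix.of fun i j =>
    if j = Fin.last k then (if i = 0 then 1 else 0) else H (2 * ((j : ℤ) + 1) - r i)

theorem det_hMatrixAug {k : ℕ} (r : Fin (k + 1) → ℤ) :
    (hMatrixAug H r).det = (-1) ^ k * hDet H fun i => r i.succ := by
  rw [Matrix.det_succ_column _ (Fin.last k), Finset.sum_eq_single 0]
  · have : (hMatrixAug H r).submatrix (Fin.succAbove 0) (Fin.last k).succAbove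
        = hMatrix H fun i => r i.succ := by
      ext i j
      simp [hMatrixAug, hMatrix, (Fin.castSucc_lt_last j).ne]
    rw [this]
    simp [hMatrixAug, hDet]
  · intro i _ hi
    simp [hMatrixAug, hi]
  · simp

variable (hH : ∀ n < 0, H n = 0) (hH0 : H 0 = 1)

include hH hH0

theorem hDet_succ {k : ℕ} (r : Fin (k + 1) → ℤ) (h0 : r 0 = 2) (hr : ∀ i : Fin k, 2 < r i.succ) :
    hDet H r = hDet H fun i => r i.succ - 2 := by
  rw [hDet, Matrix.det_succ_column_zero, Finset.sum_eq_single 0]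
  · have : (hMatrix H r).submatrix (Fin.succAbove 0) Fin.succ
        = hMatrix H fun i => r i.succ - 2 := by
      ext i j
      simp only [hMatrix, Matrix.submatrix_apply, Matrix.of_apply, Fin.zero_succAbove,
        Fin.val_succ]
      congr 1
      push_cast
      ring
    rw [this]
    simp [hMatrix, h0, hH0, hDet]
  · intro i _ hi
    obtain ⟨i, rfl⟩ := Fin.exists_succ_eq.mpr hi
    have := hr i
    have h : H (2 - r i.succ) = 0 := hH _ (by omega)
    simp [hMatrix, h]
  · simp

theorem hDet_stair_succ (k : ℕ) :
    (hDet H fun i : Fin (k + 1) => stair (k + 2) i.succ) = hDet H (stair k) := by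
  rw [hDet_succ H hH hH0 _ (by simp [stair]) (by intro i; simp [stair]; omega)]
  refine congrArg (hDet H) (funext fun i => ?_)
  simp [stair]
  ring

/-- Removing the first row, and with it the last column, from the Wronskian whose last row is
differentiated. -/
theorem hDet_stair_add_single_succ (δ : Derivation A R R) (hδ : ∀ n, δ (H n) = H (n - 1)) (k : ℕ) :
    (hDet H fun i : Fin (k + 1) =>
      (stair (k + 2) + Pi.single (Fin.last (k + 1)) 1 : Fin (k + 2) → ℤ) i.succ)
      = δ (hDet H (stair k)) := by
  cases k with
  | zero =>
    have h : H (-1) = 0 := hH _ (by norm_num)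
    simp [hDet, hMatrix, stair, h]
  | succ k =>
    rw [derivation_hDet_stair H δ hδ, hDet_succ H hH hH0]
    · refine congrArg (hDet H) (funext fun i => ?_)
      by_cases hi : i = Fin.last k
      · subst hi
        simp [stair]
        ring
      · have h : i.succ.succ ≠ Fin.last (k + 1 + 1) := by simpa [Fin.ext_iff] using hi
        simp [stair, hi, h]
        ring
    · have h : (0 : Fin (k + 2)).succ ≠ Fin.last (k + 1 + 1) := by simp [Fin.ext_iff]
      simp only [Pi.add_apply, Pi.single_eq_of_ne h]
      simp [stair]
    · intro i
      have h2 : 0 ≤ (Pi.single (Fin.last (k + 1 + 1)) 1 : Fin (k + 3) → ℤ) i.succ.succ := by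
        by_cases h : i.succ.succ = Fin.last (k + 1 + 1)
        · rw [h]; simp
        · rw [Pi.single_eq_of_ne h]
      simp only [Pi.add_apply, stair, Fin.val_succ]
      push_cast
      omega

/-- The Adler–Moser equation. It is the Desnanot–Jacobi identity for the Wronskian matrix of the
functions `H 1, H 3, …, H (2 n + 3), 1`: the derivatives of `H 1, H 3, …` are again
such functions, so that the minors with the column of `1` are Wronskians of smaller size. -/
theorem hDet_wronskian_of_ne_zero [IsDomain R] (δ : Derivation A R R)
    (hδ : ∀ n, δ (H n) = H (n - 1)) (n : ℕ) (hn : hDet H (stair (n + 1)) ≠ 0) :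
    δ (hDet H (stair (n + 2))) * hDet H (stair n) - hDet H (stair (n + 2)) * δ (hDet H (stair n))
      = hDet H (stair (n + 1)) ^ 2 := by
  set M := hMatrixAug H (stair (n + 3)) with hM
  have hA : M.submatrix (Fin.castAdd 2) (Fin.castAdd 2) = hMatrix H (stair (n + 1)) := by
    ext i j
    have h : Fin.castAdd 2 j ≠ Fin.last (n + 2) := by
      simp only [ne_eq, Fin.ext_iff, Fin.val_castAdd, Fin.val_last]; omega
    simp [hM, hMatrixAug, hMatrix, h, stair]
  have key := desnanot_jacobi M _ rfl (by rw [hA]; exact hn)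
  have hrow : ∀ i, stair (n + 3) ((Fin.last (n + 1)).castSucc.succAbove i)
      = (stair (n + 2) + Pi.single (Fin.last (n + 1)) 1 : Fin (n + 2) → ℤ) i := by
    intro i
    induction i using Fin.lastCases with
    | last =>
      rw [Fin.succAbove_of_le_castSucc _ _ le_rfl]
      simp [stair]
    | cast i =>
      rw [Fin.succAbove_of_castSucc_lt _ _
        (Fin.castSucc_lt_castSucc_iff.mpr (Fin.castSucc_lt_last i))]
      simp [stair, (Fin.castSucc_lt_last i).ne]
  have hcol : ∀ j, (Fin.last (n + 1)).castSucc.succAbove j = Fin.last (n + 2)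
      ↔ j = Fin.last (n + 1) := by
    intro j
    induction j using Fin.lastCases with
    | last =>
      rw [Fin.succAbove_of_le_castSucc _ _ le_rfl]
      simp
    | cast j =>
      rw [Fin.succAbove_of_castSucc_lt _ _
        (Fin.castSucc_lt_castSucc_iff.mpr (Fin.castSucc_lt_last j))]
      simp [(Fin.castSucc_lt_last j).ne, Fin.ext_iff]
      omega
  have hcolv : ∀ j, j ≠ Fin.last (n + 1) →
      (((Fin.last (n + 1)).castSucc.succAbove j : Fin (n + 3)) : ℤ) = j := by
    intro j hj
    rw [Fin.succAbove_of_castSucc_lt _ _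
      (Fin.castSucc_lt_castSucc_iff.mpr (Fin.lt_last_iff_ne_last.mpr hj))]
    simp
  have hrow0 : ∀ i, (Fin.last (n + 1)).castSucc.succAbove i = 0 ↔ i = 0 := by
    intro i
    exact Fin.succAbove_eq_zero_iff (by simp [Fin.ext_iff])
  have m00 : M.submatrix Fin.castSucc Fin.castSucc = hMatrix H (stair (n + 2)) := by
    ext i j
    simp [hM, hMatrixAug, hMatrix, (Fin.castSucc_lt_last j).ne, stair]
  have m10 : M.submatrix (Fin.last (n + 1)).castSucc.succAbove Fin.castSucc
      = hMatrix H (stair (n + 2) + Pi.single (Fin.last (n + 1)) 1) := by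
    ext i j
    simp only [hM, hMatrixAug, hMatrix, (Fin.castSucc_lt_last j).ne, Matrix.submatrix_apply,
      Matrix.of_apply, hrow, if_false, Fin.val_castSucc]
  have m01 : M.submatrix Fin.castSucc (Fin.last (n + 1)).castSucc.succAbove
      = hMatrixAug H (stair (n + 2)) := by
    ext i j
    simp only [hM, hMatrixAug, Matrix.submatrix_apply, Matrix.of_apply, hcol,
      Fin.castSucc_eq_zero_iff]
    by_cases hj : j = Fin.last (n + 1)
    · simp [hj]
    · simp [hj, hcolv j hj, stair]
  have m11 : M.submatrix (Fin.last (n + 1)).castSucc.succAbove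
        (Fin.last (n + 1)).castSucc.succAbove
      = hMatrixAug H (stair (n + 2) + Pi.single (Fin.last (n + 1)) 1) := by
    ext i j
    simp only [hM, hMatrixAug, Matrix.submatrix_apply, Matrix.of_apply, hcol, hrow0, hrow]
    by_cases hj : j = Fin.last (n + 1)
    · simp [hj]
    · simp [hj, hcolv j hj]
  simp only [Matrix.cons_val_zero, Matrix.cons_val_one] at key
  rw [hA, m00, m10, m01, m11, hM, det_hMatrixAug, det_hMatrixAug, det_hMatrixAug,
    hDet_stair_succ H hH hH0, hDet_stair_succ H hH hH0,
    hDet_stair_add_single_succ H hH hH0 δ hδ] at key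
  change hDet H _ * _ = hDet H _ * _ - _ * hDet H _ at key
  rw [← derivation_hDet_stair H δ hδ] at key
  have hsq : ((-1 : R) ^ n) ^ 2 = 1 := by rw [← pow_mul, mul_comm, pow_mul]; simp
  simp only [pow_succ] at key
  linear_combination (-1 : R) ^ n * (-key)
    + (hDet H (stair (n + 1)) ^ 2 + hDet H (stair (n + 2)) * δ (hDet H (stair n))
      - δ (hDet H (stair (n + 2))) * hDet H (stair n)) * hsq

theorem hDet_stair_ne_zero [IsDomain R] (δ : Derivation A R R) (hδ : ∀ n, δ (H n) = H (n - 1)) :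
    ∀ n, hDet H (stair n) ≠ 0
  | 0 => by simp [hDet]
  | 1 => by
    intro h
    have h1 : hDet H (stair 1) = H 1 := by simp [hDet, hMatrix, stair]
    have h2 : δ (H 1) = 1 := by rw [hδ, sub_self, hH0]
    rw [← h1, h, map_zero] at h2
    exact zero_ne_one h2
  | n + 2 => by
    intro h
    have h1 := hDet_stair_ne_zero δ hδ (n + 1)
    have h2 := hDet_wronskian_of_ne_zero H hH hH0 δ hδ n h1
    rw [h, map_zero, zero_mul, zero_mul, sub_zero] at h2
    exact pow_ne_zero 2 h1 h2.symm

theorem hDet_wronskian [IsDomain R] (δ : Derivation A R R)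
    (hδ : ∀ n, δ (H n) = H (n - 1)) (n : ℕ) :
    δ (hDet H (stair (n + 2))) * hDet H (stair n) - hDet H (stair (n + 2)) * δ (hDet H (stair n))
      = hDet H (stair (n + 1)) ^ 2 :=
  hDet_wronskian_of_ne_zero H hH hH0 δ hδ n (hDet_stair_ne_zero H hH hH0 δ hδ (n + 1))

end Wronskian
end AdlerMoser

/-! ### Complete homogeneous polynomials in the odd times -/

namespace AdlerMoser
open Finset Matrix

section CompleteHomogeneous

variable {R : Type*} [CommRing R] [Algebra ℂ R]

/-- The complete homogeneous polynomials in the odd times `t 0, t 1, t 2, …`, defined by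
`∑ h_n λ^n = exp (∑ t_i λ^(2 i + 1))`, or equivalently by Newton's recursion
`n h_n = ∑ (2 i + 1) t_i h_{n - 2 i - 1}`. -/
def hSeq (t : ℕ → R) : ℕ → R
  | 0 => 1
  | n + 1 => algebraMap ℂ R ((n + 1 : ℂ)⁻¹) *
      ∑ i : Fin (n / 2 + 1), (2 * ((i : ℕ) : R) + 1) * t i * hSeq t (n - 2 * i)

/-- The complete homogeneous polynomials, extended by zero to negative indices. -/
def hInt (t : ℕ → R) (n : ℤ) : R := if n < 0 then 0 else hSeq t n.toNat

theorem hInt_of_neg (t : ℕ → R) : ∀ n < 0, hInt t n = 0 := fun _ hn => if_pos hn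

theorem hInt_natCast (t : ℕ → R) (n : ℕ) : hInt t n = hSeq t n := by simp [hInt]

theorem hInt_zero (t : ℕ → R) : hInt t 0 = 1 := by simp [hInt, hSeq]

/-- Newton's recursion. -/
theorem cast_mul_hInt (t : ℕ → R) (n : ℤ) (K : ℕ) (hK : n ≤ 2 * K) :
    (n : R) * hInt t n
      = ∑ i ∈ Finset.range K, (2 * (i : R) + 1) * t i * hInt t (n - (2 * i + 1)) := by
  rcases lt_trichotomy n 0 with hn | rfl | hn
  · rw [hInt_of_neg t n hn, mul_zero]
    refine (Finset.sum_eq_zero fun i _ => ?_).symm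
    rw [hInt_of_neg t _ (by omega), mul_zero]
  · rw [Int.cast_zero, zero_mul]
    refine (Finset.sum_eq_zero fun i _ => ?_).symm
    rw [hInt_of_neg t _ (by omega), mul_zero]
  · obtain ⟨m, rfl⟩ : ∃ m : ℕ, n = (m : ℤ) + 1 := ⟨(n - 1).toNat, by omega⟩
    have h1 : hInt t ((m : ℤ) + 1) = hSeq t (m + 1) := by exact_mod_cast hInt_natCast t (m + 1)
    have hm : ((m : ℂ) + 1) ≠ 0 := Nat.cast_add_one_ne_zero m
    have h2 : (((m : ℤ) + 1 : ℤ) : R) = algebraMap ℂ R ((m : ℂ) + 1) := by simp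
    rw [h1, hSeq, h2, ← mul_assoc, ← map_mul, mul_inv_cancel₀ hm, map_one, one_mul,
      Fin.sum_univ_eq_sum_range (fun i => (2 * (i : R) + 1) * t i * hSeq t (m - 2 * i))]
    have hsub : Finset.range (m / 2 + 1) ⊆ Finset.range K :=
      Finset.range_subset_range.mpr (by omega)
    rw [← Finset.sum_subset hsub]
    · refine Finset.sum_congr rfl fun i hi => ?_
      have hi' : 2 * i ≤ m := by
        have := Finset.mem_range.mp hi
        omega
      rw [← hInt_natCast]
      congr 2
      push_cast [Nat.cast_sub hi']
      ring
    · intro i _ hi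
      have hi' : ¬ 2 * i ≤ m := by
        rw [Finset.mem_range] at hi
        omega
      rw [hInt_of_neg t _ (by omega), mul_zero]

theorem algebra_nat_cancel {n : ℕ} (hn : n ≠ 0) {a b : R} (h : (n : R) * a = n * b) : a = b := by
  have hn' : (n : ℂ) ≠ 0 := Nat.cast_ne_zero.mpr hn
  have h1 : algebraMap ℂ R (n : ℂ)⁻¹ * (n : R) = 1 := by
    rw [← map_natCast (algebraMap ℂ R) n, ← map_mul, inv_mul_cancel₀ hn', map_one]
  rw [← one_mul a, ← one_mul b, ← h1, mul_assoc, mul_assoc, h]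

/-- The chain rule: `∂ h_n / ∂ t_i = h_{n - 2 i - 1}`. -/
theorem derivation_hInt (δ : Derivation ℂ R R) (t : ℕ → R) (K : ℕ) (n : ℤ) (hK : n ≤ 2 * K) :
    δ (hInt t n) = ∑ i ∈ Finset.range K, δ (t i) * hInt t (n - (2 * i + 1)) := by
  have neg_case : ∀ n : ℤ, n ≤ 0 →
      δ (hInt t n) = ∑ i ∈ Finset.range K, δ (t i) * hInt t (n - (2 * i + 1)) := by
    intro n hn
    rw [Finset.sum_eq_zero fun i _ => by rw [hInt_of_neg t _ (by omega), mul_zero]]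
    rcases hn.lt_or_eq with h | rfl
    · rw [hInt_of_neg t n h, map_zero]
    · rw [hInt_zero, Derivation.map_one_eq_zero]
  rcases le_or_gt n 0 with hn | hn
  · exact neg_case n hn
  -- Differentiate Newton's recursion, and apply it once more to the terms containing `δ (t l)`.
  obtain ⟨m, rfl⟩ : ∃ m : ℕ, n = m := ⟨n.toNat, by omega⟩
  induction m using Nat.strong_induction_on with
  | _ m ih =>
    have ih' : ∀ i : ℕ, δ (hInt t (m - (2 * i + 1)))
        = ∑ l ∈ Finset.range K, δ (t l) * hInt t (m - (2 * i + 1) - (2 * l + 1)) := by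
      intro i
      rcases le_or_gt ((m : ℤ) - (2 * i + 1)) 0 with h | h
      · exact neg_case _ h
      · have hc : ((m - (2 * i + 1) : ℕ) : ℤ) = (m : ℤ) - (2 * i + 1) := by omega
        have := ih (m - (2 * i + 1)) (by omega) (by omega) (by omega)
        rwa [hc] at this
    apply algebra_nat_cancel (n := m) (by omega)
    have hrec := congrArg δ (cast_mul_hInt t m K hK)
    rw [Derivation.leibniz, map_sum, Int.cast_natCast, Derivation.map_natCast, smul_zero,
      add_zero, smul_eq_mul] at hrec
    rw [hrec]
    have hterm : ∀ i ∈ Finset.range K,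
        δ ((2 * (i : R) + 1) * t i * hInt t (m - (2 * i + 1)))
        = (2 * (i : R) + 1) * δ (t i) * hInt t (m - (2 * i + 1))
          + ∑ l ∈ Finset.range K, δ (t l) *
            ((2 * (i : R) + 1) * t i * hInt t (m - (2 * l + 1) - (2 * i + 1))) := by
      intro i _
      have hc : δ (2 * (i : R) + 1) = 0 := by
        exact_mod_cast δ.map_natCast (2 * i + 1)
      rw [Derivation.leibniz, Derivation.leibniz, hc, ih']
      simp only [smul_eq_mul, mul_zero, add_zero]
      rw [add_comm, Finset.mul_sum]
      congr 1
      · ring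
      · refine Finset.sum_congr rfl fun l _ => ?_
        rw [sub_right_comm]
        ring
    rw [Finset.sum_congr rfl hterm, Finset.sum_add_distrib, Finset.sum_comm, Finset.mul_sum,
      ← Finset.sum_add_distrib]
    refine Finset.sum_congr rfl fun l _ => ?_
    rw [← Finset.mul_sum, ← cast_mul_hInt t (m - (2 * l + 1)) K (by omega)]
    push_cast
    ring

theorem derivation_hInt_of_single (δ : Derivation ℂ R R) (t : ℕ → R) (m : ℕ)
    (h1 : δ (t m) = 1) (h0 : ∀ i, i ≠ m → δ (t i) = 0) (n : ℤ) :
    δ (hInt t n) = hInt t (n - (2 * m + 1)) := by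
  rw [derivation_hInt δ t (n.toNat + m + 1) n (by omega), Finset.sum_eq_single m]
  · rw [h1, one_mul]
  · intro i _ hi
    rw [h0 i hi, zero_mul]
  · intro h
    exact absurd (Finset.mem_range.mpr (by omega)) h

theorem derivation_hInt_euler (δ : Derivation ℂ R R) (t : ℕ → R)
    (h : ∀ i, δ (t i) = (2 * (i : R) + 1) * t i) (n : ℤ) :
    δ (hInt t n) = (n : R) * hInt t n := by
  rw [derivation_hInt δ t n.toNat n (by omega), cast_mul_hInt t n n.toNat (by omega)]
  exact Finset.sum_congr rfl fun i _ => by rw [h]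

/-- The derivation `∑ (2 i + 1) t_i ∂ / ∂ t_{i + m}` of genus `g` multiplies `h_n` by a weight and
lowers its index. Only for `n ≤ 2 g` are the times beyond the genus irrelevant. -/
theorem derivation_hInt_virasoro (δ : Derivation ℂ R R) (t : ℕ → R) (m g : ℕ)
    (h0 : ∀ i < m, δ (t i) = 0)
    (h : ∀ i, i + m < g → δ (t (i + m)) = (2 * (i : R) + 1) * t i) (n : ℤ) (hn : n ≤ 2 * g) :
    δ (hInt t n) = ((n - 2 * m : ℤ) : R) * hInt t (n - 2 * m) := by
  rw [derivation_hInt δ t g n hn, cast_mul_hInt t (n - 2 * m) (g - m) (by omega)]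
  rcases le_or_gt m g with hmg | hmg
  · obtain ⟨k, rfl⟩ := Nat.exists_eq_add_of_le hmg
    rw [Finset.sum_range_add, Finset.sum_eq_zero fun i hi => by
      rw [h0 i (Finset.mem_range.mp hi), zero_mul], zero_add, Nat.add_sub_cancel_left]
    refine Finset.sum_congr rfl fun i hi => ?_
    have := Finset.mem_range.mp hi
    rw [add_comm m i, h i (by omega)]
    congr 2
    push_cast
    ring
  · rw [Finset.sum_eq_zero fun i hi => by
      rw [h0 i (by have := Finset.mem_range.mp hi; omega), zero_mul], Nat.sub_eq_zero_of_le hmg.le]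
    simp

theorem hSeq_congr {t u : ℕ → R} : ∀ n : ℕ, (∀ i, 2 * i + 1 ≤ n → t i = u i) → hSeq t n = hSeq u n
  | 0, _ => by simp [hSeq]
  | n + 1, h => by
    simp only [hSeq]
    congr 1
    refine Finset.sum_congr rfl fun i _ => ?_
    have hi : 2 * (i : ℕ) ≤ n := by have := i.2; omega
    rw [h i (by omega), hSeq_congr (n - 2 * i) fun l hl => h l (by omega)]

theorem hInt_congr {t u : ℕ → R} (n : ℤ) (h : ∀ i : ℕ, 2 * (i : ℤ) + 1 ≤ n → t i = u i) :
    hInt t n = hInt u n := by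
  unfold hInt
  split_ifs with hn
  · rfl
  · exact hSeq_congr _ fun i hi => h i (by omega)

/-- The last time enters `h_{2 k + 1}` linearly. -/
theorem hInt_update (t : ℕ → R) (k : ℕ) :
    hInt t (2 * k + 1) = hInt (Function.update t k 0) (2 * k + 1) + t k := by
  have e1 : ∀ u : ℕ → R, hInt u (2 * k + 1) = hSeq u (2 * k + 1) := fun u => by
    exact_mod_cast hInt_natCast u (2 * k + 1)
  have hk : ((((2 * k : ℕ) : ℂ) + 1)) ≠ 0 := Nat.cast_add_one_ne_zero _
  have e2 : ∀ u : ℕ → R, hSeq u (2 * k + 1) = algebraMap ℂ R ((((2 * k : ℕ) : ℂ) + 1)⁻¹) *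
      ∑ i ∈ Finset.range k, (2 * (i : R) + 1) * u i * hSeq u (2 * k - 2 * i) + u k := by
    intro u
    rw [hSeq, Fin.sum_univ_eq_sum_range (fun i => (2 * (i : R) + 1) * u i * hSeq u (2 * k - 2 * i)),
      show 2 * k / 2 = k by omega, Finset.sum_range_succ, mul_add]
    congr 1
    have : (2 * (k : R) + 1) = algebraMap ℂ R (((2 * k : ℕ) : ℂ) + 1) := by
      rw [show ((2 * k : ℕ) : ℂ) + 1 = ((2 * k + 1 : ℕ) : ℂ) by push_cast; ring, map_natCast]
      push_cast
      ring
    rw [this, Nat.sub_self, hSeq, mul_one, ← mul_assoc, ← map_mul, inv_mul_cancel₀ hk, map_one,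
      one_mul]
  rw [e1, e1, e2 t, e2 (Function.update t k 0), Function.update_self, add_zero]
  congr 2
  refine Finset.sum_congr rfl fun i hi => ?_
  have hi' := Finset.mem_range.mp hi
  rw [Function.update_of_ne hi'.ne,
    hSeq_congr (t := t) (u := Function.update t k 0) (2 * k - 2 * i) fun l hl => by
      rw [Function.update_of_ne (by omega)]]

variable {R' : Type*} [CommRing R'] [Algebra ℂ R']

theorem map_hSeq (f : R →ₐ[ℂ] R') (t : ℕ → R) :
    ∀ n : ℕ, f (hSeq t n) = hSeq (fun i => f (t i)) n
  | 0 => by simp [hSeq]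
  | n + 1 => by
    simp only [hSeq, map_mul, AlgHom.commutes, map_sum, map_add, map_one, map_natCast, map_ofNat]
    congr 1
    refine Finset.sum_congr rfl fun i _ => ?_
    rw [map_hSeq f t (n - 2 * i)]

theorem map_hInt (f : R →ₐ[ℂ] R') (t : ℕ → R) (n : ℤ) :
    f (hInt t n) = hInt (fun i => f (t i)) n := by
  unfold hInt
  split_ifs
  · exact map_zero f
  · exact map_hSeq f t _

end CompleteHomogeneous

section TauDeterminant

variable {R : Type*} [CommRing R] [Algebra ℂ R] {R' : Type*} [CommRing R'] [Algebra ℂ R']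

/-- The Schur polynomial of the staircase partition `(k, k - 1, …, 1)` in the odd times `t`: the
Wronskian of `h_1, h_3, …, h_{2 k - 1}` with respect to `t 0`. -/
def tauDet (t : ℕ → R) (k : ℕ) : R := hDet (hInt t) (stair k)

theorem map_tauDet (f : R →ₐ[ℂ] R') (t : ℕ → R) (k : ℕ) :
    f (tauDet t k) = tauDet (fun i => f (t i)) k := by
  rw [tauDet, hDet, AlgHom.map_det, tauDet, hDet]
  congr 1
  ext i j
  simp [hMatrix, map_hInt]

theorem tauDet_congr {t u : ℕ → R} (k : ℕ) (h : ∀ i < k, t i = u i) : tauDet t k = tauDet u k := by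
  rw [tauDet, hDet, tauDet, hDet]
  congr 1
  ext i j
  simp only [hMatrix, Matrix.of_apply, stair]
  exact hInt_congr _ fun l hl => h l (by omega)

theorem derivation_tauDet_eq_zero (δ : Derivation ℂ R R) (t : ℕ → R) (h : ∀ i, δ (t i) = 0)
    (k : ℕ) : δ (tauDet t k) = 0 := by
  rw [tauDet, hDet, derivation_det]
  refine Finset.sum_eq_zero fun i _ => Matrix.det_eq_zero_of_row_eq_zero i fun j => ?_
  rw [Matrix.updateRow_self, hMatrix, Matrix.of_apply,
    derivation_hInt δ t (2 * ((j : ℤ) + 1) - stair k i).toNat _ (by omega)]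
  simp [h]

/-- The weight `k (k + 1) / 2` of the staircase polynomials. -/
def wt (k : ℕ) : ℕ := k * (k + 1) / 2

theorem two_mul_wt (k : ℕ) : 2 * wt k = k * (k + 1) :=
  Nat.mul_div_cancel' (Nat.even_mul_succ_self k).two_dvd

theorem wt_add_two (k : ℕ) : wt (k + 2) = wt k + (2 * k + 3) := by
  have h1 := two_mul_wt k
  have h2 := two_mul_wt (k + 2)
  nlinarith

theorem derivation_tauDet_euler (δ : Derivation ℂ R R) (t : ℕ → R)
    (h : ∀ i, δ (t i) = (2 * (i : R) + 1) * t i) (k : ℕ) :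
    δ (tauDet t k) = (wt k : R) * tauDet t k := by
  rw [tauDet, derivation_hDet_euler _ _ δ (derivation_hInt_euler δ t h)]
  congr 1
  have h1 : (∑ j : Fin k, 2 * ((j : ℤ) + 1) - ∑ i, stair k i : ℤ) = (wt k : ℤ) := by
    have h2 : ∑ j : Fin k, 2 * ((j : ℤ) + 1) = 2 * ∑ i, stair k i := by
      simp [Finset.mul_sum, stair]
    have h3 : ∑ i, stair k i = (wt k : ℤ) := by
      have h4 : ∑ i : Fin k, ((i : ℤ) + 1) = ∑ i ∈ Finset.range k, ((i : ℤ) + 1) :=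
        Fin.sum_univ_eq_sum_range (fun i => (i : ℤ) + 1) k
      simp only [stair]
      rw [h4]
      have h5 := two_mul_wt k
      zify at h5
      have h6 : ∀ k : ℕ, 2 * ∑ i ∈ Finset.range k, ((i : ℤ) + 1) = (k : ℤ) * (k + 1) := by
        intro k
        induction k with
        | zero => simp
        | succ k ih => rw [Finset.sum_range_succ, mul_add, ih]; push_cast; ring
      have := h6 k
      omega
    rw [h2, h3]
    ring
  rw [h1, Int.cast_natCast]

theorem tauDet_wronskian [IsDomain R] (δ : Derivation ℂ R R) (t : ℕ → R) (h1 : δ (t 0) = 1)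
    (h0 : ∀ i, i ≠ 0 → δ (t i) = 0) (n : ℕ) :
    δ (tauDet t (n + 2)) * tauDet t n - tauDet t (n + 2) * δ (tauDet t n)
      = tauDet t (n + 1) ^ 2 :=
  hDet_wronskian _ (hInt_of_neg t) (hInt_zero t) δ
    (fun n => by simpa using derivation_hInt_of_single δ t 0 h1 h0 n) n

/-- The last time enters the staircase polynomial linearly, through the corner of the matrix, and
its coefficient is the staircase polynomial of size two less. -/
theorem tauDet_update (t : ℕ → R) (k : ℕ) :
    tauDet t (k + 2) = tauDet (Function.update t (k + 1) 0) (k + 2)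
      + (-1) ^ (k + 1) * t (k + 1) * tauDet t k := by
  set u := Function.update t (k + 1) 0 with hu
  set M := hMatrix (hInt u) (stair (k + 2)) with hM
  have hM' : hMatrix (hInt t) (stair (k + 2))
      = M.updateRow 0 (M 0 + t (k + 1) • Pi.single (Fin.last (k + 1)) 1) := by
    ext i j
    by_cases hi : i = 0
    · subst hi
      by_cases hj : j = Fin.last (k + 1)
      · subst hj
        have := hInt_update t (k + 1)
        simp only [hM, hMatrix, stair, Matrix.of_apply, Matrix.updateRow_self, Pi.add_apply,
          Pi.smul_apply, Pi.single_eq_same, smul_eq_mul, mul_one, Fin.val_last, Fin.val_zero]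
        have e : 2 * (((k + 1 : ℕ) : ℤ) + 1) - (((0 : ℕ) : ℤ) + 1) = 2 * ((k + 1 : ℕ) : ℤ) + 1 := by
          push_cast
          ring
        rw [e]
        exact this
      · have hj' : (j : ℕ) < k + 1 := Fin.val_lt_last hj
        simp only [hM, hMatrix, stair, Matrix.of_apply, Matrix.updateRow_self, Pi.add_apply,
          Pi.smul_apply, Pi.single_eq_of_ne hj, smul_zero, add_zero, Fin.val_zero]
        refine hInt_congr _ fun l hl => ?_
        rw [hu, Function.update_of_ne (by push_cast at hl; omega)]
    · have hi' : 1 ≤ (i : ℕ) := Nat.one_le_iff_ne_zero.mpr fun h => hi (Fin.ext h)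
      simp only [hM, hMatrix, stair, Matrix.of_apply, Matrix.updateRow_ne hi]
      refine hInt_congr _ fun l hl => ?_
      rw [hu, Function.update_of_ne (by omega)]
  have hcorner : (M.updateRow 0 (Pi.single (Fin.last (k + 1)) 1)).det
      = (-1) ^ (k + 1) * tauDet t k := by
    rw [← Matrix.adjugate_apply, Matrix.adjugate_fin_succ_eq_det_submatrix]
    have hsub : M.submatrix (Fin.succAbove 0) (Fin.last (k + 1)).succAbove
        = hMatrix (hInt u) fun i : Fin (k + 1) => stair (k + 2) i.succ := by
      ext i j
      simp [hM, hMatrix]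
    have hd := hDet_stair_succ (hInt u) (hInt_of_neg u) (hInt_zero u) k
    rw [hDet] at hd
    rw [hsub, hd, tauDet_congr (t := t) (u := u) k fun i hi => by
      rw [hu, Function.update_of_ne (by omega)]]
    simp [tauDet]
  rw [tauDet, hDet, hM', Matrix.det_updateRow_add, Matrix.updateRow_eq_self,
    Matrix.det_updateRow_smul, hcorner]
  change tauDet u (k + 2) + _ = _
  ring

end TauDeterminant

end AdlerMoser

/-! ### Normalization and Wronskians of polynomials -/

namespace AdlerMoser
open Finset Matrix

section Normalization

variable {R : Type*} [CommRing R] [Algebra ℂ R] {R' : Type*} [CommRing R'] [Algebra ℂ R']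

theorem tauDet_zero (t : ℕ → R) : tauDet t 0 = 1 := by simp [tauDet, hDet]

theorem tauDet_one (t : ℕ → R) : tauDet t 1 = t 0 := by
  have h := cast_mul_hInt t 1 1 (by norm_num)
  simp [hInt_zero] at h
  simp [tauDet, hDet, hMatrix, stair, h]

/-- The coefficient of `t_0 ^ (k (k + 1) / 2)` in the staircase polynomial. -/
def leadConst (k : ℕ) : ℂ := tauDet (fun i => if i = 0 then 1 else 0) k

/-- The Adler–Moser equation at the times `(x, 0, 0, …)`, where the staircase polynomial is
a multiple of a power of `x`, evaluated at `x = 1`. -/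
theorem leadConst_rel (n : ℕ) :
    (2 * ((n : ℂ) + 1) + 1) * (leadConst (n + 2) * leadConst n) = leadConst (n + 1) ^ 2 := by
  set t : ℕ → Polynomial ℂ := fun i => if i = 0 then Polynomial.X else 0 with ht
  have hev : ∀ k, Polynomial.aeval (1 : ℂ) (tauDet t k) = leadConst k := by
    intro k
    rw [map_tauDet, leadConst]
    congr 1
    funext i
    by_cases hi : i = 0 <;> simp [ht, hi]
  have heul : ∀ k, Polynomial.aeval (1 : ℂ) (Polynomial.derivative' (tauDet t k))
      = wt k * leadConst k := by
    intro k
    have h := derivation_tauDet_euler ((Polynomial.X : Polynomial ℂ) • Polynomial.derivative') t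
      (by
        intro i
        by_cases hi : i = 0 <;> simp [ht, hi]) k
    have h2 := congrArg (Polynomial.aeval (1 : ℂ)) h
    rw [Derivation.smul_apply, smul_eq_mul, map_mul, map_mul, hev] at h2
    simpa using h2
  have hw := congrArg (Polynomial.aeval (1 : ℂ)) (tauDet_wronskian Polynomial.derivative' t
    (by simp [ht]) (by intro i hi; simp [ht, hi]) n)
  rw [map_sub, map_mul, map_mul, map_pow, hev, hev, hev, heul, heul, wt_add_two] at hw
  rw [← hw]
  push_cast
  ring

theorem leadConst_ne_zero : ∀ n, leadConst n ≠ 0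
  | 0 => by simp [leadConst, tauDet_zero]
  | 1 => by simp [leadConst, tauDet_one]
  | n + 2 => by
    intro h
    have := leadConst_rel n
    rw [h, zero_mul, mul_zero] at this
    exact pow_ne_zero 2 (leadConst_ne_zero (n + 1)) this.symm

/-- The staircase polynomial, normalized to be monic in `t 0`. -/
def amTau (t : ℕ → R) (k : ℕ) : R := algebraMap ℂ R (leadConst k)⁻¹ * tauDet t k

theorem amTau_zero (t : ℕ → R) : amTau t 0 = 1 := by
  simp [amTau, leadConst, tauDet_zero]

theorem amTau_one (t : ℕ → R) : amTau t 1 = t 0 := by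
  simp [amTau, leadConst, tauDet_one]

theorem map_amTau (f : R →ₐ[ℂ] R') (t : ℕ → R) (k : ℕ) :
    f (amTau t k) = amTau (fun i => f (t i)) k := by
  rw [amTau, map_mul, AlgHom.commutes, map_tauDet, amTau]

theorem amTau_congr {t u : ℕ → R} (k : ℕ) (h : ∀ i < k, t i = u i) : amTau t k = amTau u k := by
  rw [amTau, amTau, tauDet_congr k h]

theorem derivation_amTau (δ : Derivation ℂ R R) (t : ℕ → R) (k : ℕ) :
    δ (amTau t k) = algebraMap ℂ R (leadConst k)⁻¹ * δ (tauDet t k) := by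
  rw [amTau, Derivation.leibniz, Derivation.map_algebraMap, smul_zero, add_zero, smul_eq_mul]

theorem derivation_amTau_eq_zero (δ : Derivation ℂ R R) (t : ℕ → R) (k : ℕ)
    (h : ∀ i < k, δ (t i) = 0) : δ (amTau t k) = 0 := by
  have hc : amTau t k = amTau (fun i => if i < k then t i else 0) k :=
    amTau_congr k fun i hi => by simp [hi]
  rw [hc, derivation_amTau, derivation_tauDet_eq_zero, mul_zero]
  intro i
  by_cases hi : i < k
  · simp [hi, h i hi]
  · simp [hi]

theorem derivation_amTau_euler (δ : Derivation ℂ R R) (t : ℕ → R)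
    (h : ∀ i, δ (t i) = (2 * (i : R) + 1) * t i) (k : ℕ) :
    δ (amTau t k) = (wt k : R) * amTau t k := by
  rw [derivation_amTau, derivation_tauDet_euler δ t h, amTau]
  ring

theorem amTau_wronskian [IsDomain R] (δ : Derivation ℂ R R) (t : ℕ → R) (h1 : δ (t 0) = 1)
    (h0 : ∀ i, i ≠ 0 → δ (t i) = 0) (n : ℕ) :
    δ (amTau t (n + 2)) * amTau t n - amTau t (n + 2) * δ (amTau t n)
      = algebraMap ℂ R (2 * ((n : ℂ) + 1) + 1) * amTau t (n + 1) ^ 2 := by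
  have hc : (leadConst (n + 2))⁻¹ * (leadConst n)⁻¹
      = (2 * ((n : ℂ) + 1) + 1) * (leadConst (n + 1))⁻¹ ^ 2 := by
    have h0 := leadConst_ne_zero n
    have h1 := leadConst_ne_zero (n + 1)
    have h2 := leadConst_ne_zero (n + 2)
    have := leadConst_rel n
    field_simp
    linear_combination -this
  have hc' := congrArg (algebraMap ℂ R) hc
  rw [map_mul, map_mul, map_pow] at hc'
  have hw := tauDet_wronskian δ t h1 h0 n
  rw [derivation_amTau, derivation_amTau, amTau, amTau, amTau]
  linear_combination (algebraMap ℂ R (leadConst (n + 2))⁻¹ * algebraMap ℂ R (leadConst n)⁻¹) * hw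
    + tauDet t (n + 1) ^ 2 * hc'

/-- The coefficient with which the last time enters the normalized staircase polynomial. -/
def lastCoeff (k : ℕ) : ℂ := (-1) ^ (k + 1) * leadConst k / leadConst (k + 2)

theorem lastCoeff_ne_zero (k : ℕ) : lastCoeff k ≠ 0 :=
  div_ne_zero (mul_ne_zero (pow_ne_zero _ (by norm_num)) (leadConst_ne_zero k))
    (leadConst_ne_zero _)

theorem amTau_update_zero (t : ℕ → R) (k : ℕ) :
    amTau t (k + 2) = amTau (Function.update t (k + 1) 0) (k + 2)
      + algebraMap ℂ R (lastCoeff k) * t (k + 1) * amTau t k := by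
  have h : algebraMap ℂ R (lastCoeff k) * algebraMap ℂ R (leadConst k)⁻¹
      = algebraMap ℂ R (leadConst (k + 2))⁻¹ * (-1) ^ (k + 1) := by
    have h0 := leadConst_ne_zero k
    rw [← map_mul, show lastCoeff k * (leadConst k)⁻¹ = (leadConst (k + 2))⁻¹ * (-1) ^ (k + 1) by
      unfold lastCoeff; field_simp, map_mul, map_pow, map_neg, map_one]
  rw [amTau, tauDet_update, amTau, amTau]
  linear_combination (-(t (k + 1) * tauDet t k)) * h

theorem amTau_update (t : ℕ → R) (k : ℕ) (w : R) :
    amTau (Function.update t (k + 1) w) (k + 2) = amTau t (k + 2)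
      + algebraMap ℂ R (lastCoeff k) * (w - t (k + 1)) * amTau t k := by
  have h1 := amTau_update_zero t k
  have h2 := amTau_update_zero (Function.update t (k + 1) w) k
  rw [Function.update_idem, Function.update_self,
    amTau_congr (u := t) k fun i hi => Function.update_of_ne (by omega) _ _] at h2
  rw [h1, h2]
  ring

end Normalization

section PolynomialWronskian

open Polynomial

/-- The leading coefficient of `x (f' g - f g')` is that of `f g` times the difference of the
degrees. -/
theorem natDegree_eq_of_wronskian_eq_zero {R : Type*} [CommRing R] [IsDomain R] [CharZero R]
    {f g : R[X]} (hf : f ≠ 0) (hg : g ≠ 0) (h : derivative f * g = f * derivative g) :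
    f.natDegree = g.natDegree := by
  have hX : ∀ p : R[X], (X * derivative p).natDegree ≤ p.natDegree := by
    intro p
    rw [Polynomial.natDegree_le_iff_coeff_eq_zero]
    intro N hN
    obtain ⟨N, rfl⟩ : ∃ M, N = M + 1 := ⟨N - 1, by omega⟩
    rw [coeff_X_mul, coeff_derivative, coeff_eq_zero_of_natDegree_lt hN, zero_mul]
  have hX' : ∀ p : R[X], (X * derivative p).coeff p.natDegree = p.natDegree * p.leadingCoeff := by
    intro p
    rcases hp : p.natDegree with _ | N
    · simp
    · rw [coeff_X_mul, coeff_derivative, leadingCoeff, hp]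
      push_cast
      ring
  have h1 : (X * derivative f) * g = f * (X * derivative g) := by linear_combination X * h
  have h2 := congrArg (fun p => p.coeff (f.natDegree + g.natDegree)) h1
  rw [coeff_mul_add_eq_of_natDegree_le (hX f) le_rfl,
    coeff_mul_add_eq_of_natDegree_le le_rfl (hX g), hX', hX', coeff_natDegree,
    coeff_natDegree] at h2
  have hlf : f.leadingCoeff ≠ 0 := leadingCoeff_ne_zero.mpr hf
  have hlg : g.leadingCoeff ≠ 0 := leadingCoeff_ne_zero.mpr hg
  have h3 : ((f.natDegree : R) - g.natDegree) * (f.leadingCoeff * g.leadingCoeff) = 0 := by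
    linear_combination h2
  rcases mul_eq_zero.mp h3 with h4 | h4
  · exact_mod_cast sub_eq_zero.mp h4
  · exact absurd h4 (mul_ne_zero hlf hlg)

/-- Otherwise `f - C c * g` would be nonzero of the degree of `g`, where its coefficient is zero. -/
theorem eq_C_mul_of_wronskian_eq_zero {R : Type*} [CommRing R] [IsDomain R] [CharZero R]
    {f g : R[X]} (hg : g ≠ 0) (h : derivative f * g = f * derivative g) (c : R)
    (hc : f.coeff g.natDegree = c * g.leadingCoeff) : f = C c * g := by
  by_contra hne
  have h0 : f - C c * g ≠ 0 := sub_ne_zero.mpr hne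
  have hd := natDegree_eq_of_wronskian_eq_zero h0 hg (by
    rw [derivative_sub, derivative_C_mul]
    linear_combination h)
  have : (f - C c * g).leadingCoeff = 0 := by
    rw [leadingCoeff, hd, coeff_sub, coeff_C_mul, hc, leadingCoeff, sub_self]
  exact h0 (leadingCoeff_eq_zero.mp this)

end PolynomialWronskian

section LeadingPower

open MvPolynomial

theorem derivative_finSuccEquiv {n : ℕ} (p : MvPolynomial (Fin (n + 1)) ℂ) :
    Polynomial.derivative (finSuccEquiv ℂ n p) = finSuccEquiv ℂ n (pderiv 0 p) := by
  induction p using MvPolynomial.induction_on with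
  | C a => simp [finSuccEquiv_apply]
  | add p q hp hq => simp only [map_add, hp, hq]
  | mul_X p i hp =>
    rw [map_mul, Polynomial.derivative_mul, hp, Derivation.leibniz, map_add, smul_eq_mul,
      smul_eq_mul, map_mul, map_mul]
    induction i using Fin.cases with
    | zero =>
      rw [finSuccEquiv_X_zero, Polynomial.derivative_X, pderiv_X_self, map_one]
      ring
    | succ i =>
      rw [finSuccEquiv_X_succ, Polynomial.derivative_C, pderiv_X_of_ne (Fin.succ_ne_zero i),
        map_zero]
      ring

theorem hasLeadingPower_iff {n : ℕ} (p : MvPolynomial (Fin (n + 1)) ℂ) (N : ℕ) :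
    HasLeadingPower p N ↔ (finSuccEquiv ℂ n p - Polynomial.X ^ N).degree < (N : WithBot ℕ) := by
  have h : finSuccEquiv ℂ n p - Polynomial.X ^ N = finSuccEquiv ℂ n (p - X 0 ^ N) := by
    rw [map_sub, map_pow, finSuccEquiv_X_zero]
  rw [h, Polynomial.degree_lt_iff_coeff_zero]
  constructor
  · intro hp i hi
    ext m
    rw [finSuccEquiv_coeff_coeff, coeff_zero]
    by_contra hne
    have := hp _ (mem_support_iff.mpr hne)
    rw [Finsupp.cons_zero] at this
    omega
  · intro hp m hm
    by_contra hlt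
    have h2 := congrArg (coeff m.tail) (hp (m 0) (by omega))
    rw [finSuccEquiv_coeff_coeff, Finsupp.cons_tail, coeff_zero] at h2
    exact mem_support_iff.mp hm h2

theorem HasLeadingPower.monic {n : ℕ} {p : MvPolynomial (Fin (n + 1)) ℂ} {N : ℕ}
    (h : HasLeadingPower p N) :
    (finSuccEquiv ℂ n p).Monic ∧ (finSuccEquiv ℂ n p).natDegree = N := by
  rw [hasLeadingPower_iff] at h
  have e : finSuccEquiv ℂ n p = Polynomial.X ^ N + (finSuccEquiv ℂ n p - Polynomial.X ^ N) := by
    ring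
  have hm := Polynomial.monic_X_pow_add h
  rw [← e] at hm
  refine ⟨hm, Polynomial.natDegree_eq_of_degree_eq_some ?_⟩
  rw [e, Polynomial.degree_add_eq_left_of_degree_lt, Polynomial.degree_X_pow]
  rwa [Polynomial.degree_X_pow]

/-- If the Wronskian of `p` with a polynomial that is monic in the first variable vanishes, then `p`
is a multiple of it, by a factor without the first variable. -/
theorem exists_eq_mul_of_wronskian_eq_zero {n : ℕ} {p q : MvPolynomial (Fin (n + 1)) ℂ} {N : ℕ}
    (hq : HasLeadingPower q N) (h : pderiv 0 p * q = p * pderiv 0 q) :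
    ∃ c : MvPolynomial (Fin (n + 1)) ℂ, pderiv 0 c = 0 ∧ p = c * q := by
  obtain ⟨hm, -⟩ := hq.monic
  have h1 := congrArg (finSuccEquiv ℂ n) h
  rw [map_mul, map_mul, ← derivative_finSuccEquiv, ← derivative_finSuccEquiv] at h1
  have h2 := eq_C_mul_of_wronskian_eq_zero hm.ne_zero h1 _ (by rw [hm.leadingCoeff, mul_one])
  refine ⟨(finSuccEquiv ℂ n).symm (Polynomial.C
    ((finSuccEquiv ℂ n p).coeff (finSuccEquiv ℂ n q).natDegree)), ?_, ?_⟩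
  · apply (finSuccEquiv ℂ n).injective
    rw [← derivative_finSuccEquiv, AlgEquiv.apply_symm_apply, Polynomial.derivative_C, map_zero]
  · apply (finSuccEquiv ℂ n).injective
    rw [map_mul, AlgEquiv.apply_symm_apply]
    exact h2

/-- A polynomial whose derivative by the first variable vanishes is constant in that variable. -/
theorem finSuccEquiv_eq_C {n : ℕ} {c : MvPolynomial (Fin (n + 1)) ℂ} (h : pderiv 0 c = 0) :
    finSuccEquiv ℂ n c = Polynomial.C ((finSuccEquiv ℂ n c).coeff 0) :=
  Polynomial.eq_C_of_derivative_eq_zero (by rw [derivative_finSuccEquiv, h, map_zero])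

theorem eq_one_of_hasLeadingPower_mul {n : ℕ} {c q : MvPolynomial (Fin (n + 1)) ℂ} {N : ℕ}
    (hc : pderiv 0 c = 0) (hq : HasLeadingPower q N) (hcq : HasLeadingPower (c * q) N) : c = 1 := by
  obtain ⟨hm, hd⟩ := hq.monic
  obtain ⟨hm', hd'⟩ := hcq.monic
  have hC := finSuccEquiv_eq_C hc
  rw [map_mul, hC] at hm'
  have : (finSuccEquiv ℂ n c).coeff 0 = 1 := by
    have h := hm'.leadingCoeff
    rwa [Polynomial.leadingCoeff_mul, Polynomial.leadingCoeff_C, hm.leadingCoeff, mul_one] at h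
  apply (finSuccEquiv ℂ n).injective
  rw [hC, this, map_one, map_one]

/-- A substitution that fixes the first variable, and replaces the others by polynomials without the
first variable, preserves the leading power. -/
theorem HasLeadingPower.aeval {k n : ℕ} {p : MvPolynomial (Fin (k + 1)) ℂ} {N : ℕ}
    (h : HasLeadingPower p N) (τ : Fin (k + 1) → MvPolynomial (Fin (n + 1)) ℂ) (h0 : τ 0 = X 0)
    (hτ : ∀ i, i ≠ 0 → pderiv 0 (τ i) = 0) : HasLeadingPower (MvPolynomial.aeval τ p) N := by
  rw [hasLeadingPower_iff]
  have e : finSuccEquiv ℂ n (MvPolynomial.aeval τ p) - Polynomial.X ^ N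
      = finSuccEquiv ℂ n (MvPolynomial.aeval τ (p - X 0 ^ N)) := by
    rw [map_sub, map_sub, map_pow, map_pow, aeval_X, h0, finSuccEquiv_X_zero]
  rw [e, ← Polynomial.mem_degreeLT, MvPolynomial.aeval_def, eval₂_eq', map_sum]
  refine Submodule.sum_mem _ fun m hm => ?_
  rw [Polynomial.mem_degreeLT, map_mul, map_prod, Fin.prod_univ_succ]
  have h1 : ∀ i : Fin k, finSuccEquiv ℂ n (τ i.succ ^ m i.succ)
      = Polynomial.C ((finSuccEquiv ℂ n (τ i.succ)).coeff 0 ^ m i.succ) := fun i => by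
    rw [map_pow, finSuccEquiv_eq_C (hτ _ (Fin.succ_ne_zero i)), Polynomial.coeff_C_zero,
      Polynomial.C_pow]
  have h2 : ∀ a : ℂ, finSuccEquiv ℂ n (algebraMap ℂ _ a) = Polynomial.C (C a) := fun a => by
    simp [finSuccEquiv_apply, MvPolynomial.algebraMap_eq]
  rw [Finset.prod_congr rfl fun i _ => h1 i, ← map_prod, map_pow, h0, finSuccEquiv_X_zero, h2,
    mul_comm (Polynomial.X ^ m 0), ← mul_assoc, ← Polynomial.C_mul]
  refine (Polynomial.degree_C_mul_X_pow_le _ _).trans_lt ?_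
  exact_mod_cast h m hm

end LeadingPower

end AdlerMoser

/-! ### Vector fields on the space of times, and the solution of the system -/

namespace AdlerMoser
open Finset MvPolynomial

section VectorFields

variable {g : ℕ}

theorem z_of_lt {i : ℕ} (hi : i < g) : z g (i + 1) = X ⟨i, hi⟩ := by
  simp [z, Nat.succ_le_of_lt hi]

theorem z_of_ge {i : ℕ} (hi : g ≤ i) : z g (i + 1) = 0 := by
  rw [z, dif_neg (by omega)]

theorem pd_of_lt {i : ℕ} (hi : i < g) : pd g (i + 1) = pderiv ⟨i, hi⟩ := by
  simp [pd, Nat.succ_le_of_lt hi]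

theorem pd_z (s j : ℕ) :
    pd g s (z g (j + 1)) = if s = j + 1 ∧ j < g then 1 else 0 := by
  by_cases hs : 1 ≤ s ∧ s ≤ g
  · obtain ⟨i, rfl⟩ : ∃ i, s = i + 1 := ⟨s - 1, by omega⟩
    have hi : i < g := by omega
    rw [pd_of_lt hi]
    by_cases hj : j < g
    · rw [z_of_lt hj]
      by_cases hij : i = j
      · subst hij
        simp [hi]
      · rw [pderiv_X_of_ne (by simpa using Ne.symm hij), if_neg (by omega)]
    · rw [z_of_ge (by omega), map_zero, if_neg (by omega)]
  · have h : pd g s = 0 := by rw [pd, dif_neg hs]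
    rw [h, Derivation.zero_apply, if_neg (by omega)]

/-- The first-order parts `∑ (2 s - 1) z_{2 s - 1} ∂_{2 (s + k) - 1}` of the operators: the Euler
vector field for `k = 0`, and the first-order parts of the Virasoro operators for `k ≥ 1`. -/
def virField (g k : ℕ) : Derivation ℂ (MvPolynomial (Fin g) ℂ) (MvPolynomial (Fin g) ℂ) :=
  ∑ s ∈ Finset.Icc 1 (g - k), (C (2 * (s : ℂ) - 1) * z g s) • pd g (s + k)

theorem virField_apply (k : ℕ) (ψ : MvPolynomial (Fin g) ℂ) :
    virField g k ψ = ∑ s ∈ Finset.Icc 1 (g - k), C (2 * (s : ℂ) - 1) * z g s * pd g (s + k) ψ := by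
  have h : ∀ D : Derivation ℂ (MvPolynomial (Fin g) ℂ) (MvPolynomial (Fin g) ℂ),
      D ψ = (Pi.evalAddMonoidHom _ ψ).comp Derivation.coeFnAddMonoidHom D := fun D => rfl
  rw [h, virField, map_sum]
  rfl

theorem virField_apply_fin (k : ℕ) (ψ : MvPolynomial (Fin g) ℂ) :
    virField g k ψ
      = ∑ i : Fin g, C (2 * (i : ℂ) + 1) * (z g (i + 1) * pd g (i + 1 + k) ψ) := by
  rw [virField_apply,
    Fin.sum_univ_eq_sum_range (fun i => C (2 * (i : ℂ) + 1) * (z g (i + 1) * pd g (i + 1 + k) ψ))]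
  have h : Finset.Icc 1 (g - k) = (Finset.range (g - k)).image (· + 1) := by
    ext s
    simp only [Finset.mem_Icc, Finset.mem_image, Finset.mem_range]
    exact ⟨fun hs => ⟨s - 1, by omega, by omega⟩, by rintro ⟨i, hi, rfl⟩; omega⟩
  rw [h, Finset.sum_image fun a _ b _ hab => by simpa using hab]
  rw [← Finset.sum_subset (Finset.range_subset_range.mpr (Nat.sub_le g k))]
  · refine Finset.sum_congr rfl fun i _ => ?_
    rw [mul_assoc]
    congr 2
    push_cast
    ring
  · intro i _ hi
    rw [Finset.mem_range] at hi
    have h : pd g (i + 1 + k) = 0 := by rw [pd, dif_neg (by omega)]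
    rw [h, Derivation.zero_apply, mul_zero, mul_zero]

theorem virField_z (k j : ℕ) (hj : j + k < g) :
    virField g k (z g (j + k + 1)) = C (2 * (j : ℂ) + 1) * z g (j + 1) := by
  rw [virField_apply_fin, Finset.sum_eq_single ⟨j, by omega⟩]
  · rw [pd_z, if_pos (by simp only; omega), mul_one]
  · intro i _ hi
    rw [pd_z, if_neg fun h => hi (Fin.ext (by simp only; omega)), mul_zero, mul_zero]
  · simp

theorem virField_z_of_lt (k j : ℕ) (hj : j < k) : virField g k (z g (j + 1)) = 0 := by
  rw [virField_apply_fin]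
  refine Finset.sum_eq_zero fun i _ => ?_
  rw [pd_z, if_neg (by omega), mul_zero, mul_zero]

theorem virField_zero_z (j : ℕ) :
    virField g 0 (z g (j + 1)) = C (2 * (j : ℂ) + 1) * z g (j + 1) := by
  by_cases hj : j < g
  · simpa using virField_z 0 j (by omega)
  · rw [z_of_ge (by omega), map_zero, mul_zero]

theorem derivation_C_mul_eq (δ : Derivation ℂ (MvPolynomial (Fin g) ℂ) (MvPolynomial (Fin g) ℂ))
    (a : ℂ) (p : MvPolynomial (Fin g) ℂ) : δ (C a * p) = C a * δ p := by
  rw [C_mul', Derivation.map_smul, C_mul']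

/-- The Witt algebra relations. -/
theorem virField_commutator (k : ℕ) :
    ⁅virField g 1, virField g k⁆
      = (C (2 - 2 * (k : ℂ)) : MvPolynomial (Fin g) ℂ) • virField g (k + 1) := by
  apply MvPolynomial.derivation_ext
  rintro ⟨j, hj⟩
  rw [Derivation.commutator_apply, Derivation.smul_apply, smul_eq_mul, ← z_of_lt hj]
  have hC := fun k => derivation_C_mul_eq (virField g k)
  rcases lt_trichotomy j k with h | h | h
  · rw [virField_z_of_lt k j h, virField_z_of_lt (k + 1) j (by omega), map_zero, mul_zero]
    rcases j with _ | j
    · rw [virField_z_of_lt 1 0 (by omega), map_zero, sub_zero]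
    · rw [virField_z 1 j hj, hC, virField_z_of_lt k j (by omega), mul_zero, sub_zero]
  · subst h
    have h0 := virField_z (g := g) j 0 (by omega)
    rw [zero_add] at h0
    rw [virField_z_of_lt (j + 1) j (by omega), mul_zero, h0, hC,
      virField_z_of_lt 1 0 (by omega), mul_zero]
    rcases j with _ | j
    · rw [virField_z_of_lt 1 0 (by omega), map_zero, sub_zero]
    · rw [virField_z 1 j hj, hC, virField_z_of_lt (j + 1) j (by omega), mul_zero, sub_zero]
  · obtain ⟨i, rfl⟩ : ∃ i, j = i + (k + 1) := ⟨j - (k + 1), by omega⟩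
    have h1 := virField_z (g := g) k (i + 1) (by omega)
    have h2 := virField_z (g := g) 1 (i + k) (by omega)
    rw [show i + 1 + k = i + (k + 1) by omega] at h1
    rw [show i + k + 1 = i + (k + 1) by omega] at h2
    have h3 := virField_z (g := g) k i (by omega)
    rw [show i + k + 1 = i + (k + 1) by omega] at h3
    rw [virField_z (k + 1) i hj, h1, h2, hC, hC, virField_z 1 i (by omega), h3,
      ← mul_assoc, ← mul_assoc, ← mul_assoc, ← C_mul, ← C_mul, ← C_mul,
      ← sub_mul, ← C_sub]
    congr 2
    push_cast
    ring

theorem coeff_X_mul_pderiv_self (i : Fin g) (p : MvPolynomial (Fin g) ℂ) (m : Fin g →₀ ℕ) :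
    coeff m (X i * pderiv i p) = m i * coeff m p := by
  rw [coeff_X_mul', coeff_pderiv]
  split_ifs with h
  · have h1 : 1 ≤ m i := Nat.one_le_iff_ne_zero.mpr (Finsupp.mem_support_iff.mp h)
    have h2 : m - Finsupp.single i 1 + Finsupp.single i 1 = m :=
      tsub_add_cancel_of_le (Finsupp.single_le_iff.mpr h1)
    rw [h2, Finsupp.tsub_apply, Finsupp.single_eq_same, Nat.cast_sub h1]
    push_cast
    ring
  · rw [Finsupp.notMem_support_iff.mp h]
    simp

theorem eq_zero_of_pderiv_eq_zero {i : Fin g} {p : MvPolynomial (Fin g) ℂ} (h : pderiv i p = 0)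
    {m : Fin g →₀ ℕ} (hm : m ∈ p.support) : m i = 0 := by
  have := coeff_X_mul_pderiv_self i p m
  rw [h, mul_zero, coeff_zero] at this
  rcases mul_eq_zero.mp this.symm with h1 | h1
  · exact_mod_cast h1
  · exact absurd h1 (mem_support_iff.mp hm)

theorem notMem_vars_of_pderiv_eq_zero {i : Fin g} {p : MvPolynomial (Fin g) ℂ}
    (h : pderiv i p = 0) : i ∉ p.vars := by
  rw [mem_vars_iff_mem_support]
  rintro ⟨m, hm, hi⟩
  exact Finsupp.mem_support_iff.mp hi (eq_zero_of_pderiv_eq_zero h hm)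

theorem pderiv_pderiv_comm (i j : Fin g) (p : MvPolynomial (Fin g) ℂ) :
    pderiv i (pderiv j p) = pderiv j (pderiv i p) := by
  have h : ⁅(pderiv i : Derivation ℂ (MvPolynomial (Fin g) ℂ) (MvPolynomial (Fin g) ℂ)),
      (pderiv j : Derivation ℂ (MvPolynomial (Fin g) ℂ) (MvPolynomial (Fin g) ℂ))⁆ = 0 := by
    apply MvPolynomial.derivation_ext
    intro k
    rw [Derivation.commutator_apply, pderiv_X, pderiv_X, Derivation.zero_apply]
    by_cases h1 : k = i <;> by_cases h2 : k = j <;> simp [Pi.single_apply, h1, h2] <;>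
      split_ifs <;> simp
  have := congrArg (fun D => D p) h
  simpa [Derivation.commutator_apply, sub_eq_zero] using this

/-- An eigenvector of the Euler vector field is weighted homogeneous. -/
theorem weight_eq_of_euler {p : MvPolynomial (Fin g) ℂ} {N : ℕ}
    (h : virField g 0 p = (N : MvPolynomial (Fin g) ℂ) * p) {m : Fin g →₀ ℕ}
    (hm : m ∈ p.support) : ∑ i : Fin g, (2 * (i : ℕ) + 1) * m i = N := by
  have h1 := congrArg (coeff m) h
  rw [virField_apply_fin, coeff_sum, ← map_natCast C N, coeff_C_mul] at h1
  have h2 : ∀ i : Fin g, coeff m (C (2 * (i : ℂ) + 1) * (z g (i + 1) * pd g (i + 1 + 0) p))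
      = (((2 * (i : ℕ) + 1) * m i : ℕ) : ℂ) * coeff m p := fun i => by
    rw [coeff_C_mul, z_of_lt i.2, add_zero, pd_of_lt i.2, coeff_X_mul_pderiv_self]
    push_cast
    ring
  rw [Finset.sum_congr rfl fun i _ => h2 i, ← Finset.sum_mul, ← Nat.cast_sum] at h1
  exact_mod_cast mul_right_cancel₀ (mem_support_iff.mp hm) h1

/-- The only monomial of weight `N` of degree at least `N` in the first variable is its power. -/
theorem eq_single_of_weight {n N : ℕ} {m : Fin (n + 1) →₀ ℕ}
    (hm : ∑ i : Fin (n + 1), (2 * (i : ℕ) + 1) * m i = N) (h : N ≤ m 0) :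
    m = Finsupp.single 0 N := by
  rw [Fin.sum_univ_succ] at hm
  simp only [Fin.val_zero, mul_zero, zero_add, one_mul] at hm
  have h0 : m 0 = N := by omega
  have h1 : ∑ i : Fin n, (2 * (i.succ : ℕ) + 1) * m i.succ = 0 := by omega
  ext i
  induction i using Fin.cases with
  | zero => simpa using h0
  | succ i =>
    have := Finset.sum_eq_zero_iff.mp h1 i (Finset.mem_univ i)
    simpa using this

/-- The coefficient of the power of the first variable in a weighted homogeneous polynomial. -/
theorem coeff_single_eq_eval {n N : ℕ} {p : MvPolynomial (Fin (n + 1)) ℂ}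
    (h : virField (n + 1) 0 p = (N : MvPolynomial (Fin (n + 1)) ℂ) * p) :
    coeff (Finsupp.single 0 N) p
      = aeval (fun i : Fin (n + 1) => if i = 0 then (1 : ℂ) else 0) p := by
  have h2 : ∀ m ∈ p.support, m ≠ Finsupp.single 0 N →
      p.coeff m * ∏ i, (if i = 0 then (1 : ℂ) else 0) ^ m i = 0 := by
    intro m hm hne
    have hw := weight_eq_of_euler h hm
    obtain ⟨i, hi⟩ : ∃ i : Fin n, m i.succ ≠ 0 := by
      by_contra! hall
      refine hne (eq_single_of_weight hw ?_)
      rw [← hw, Fin.sum_univ_succ, Finset.sum_eq_zero fun i _ => by rw [hall i, mul_zero]]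
      simp
    rw [Finset.prod_eq_zero (Finset.mem_univ i.succ) (by simp [hi]), mul_zero]
  rw [aeval_def, eval₂_eq']
  simp only [Algebra.algebraMap_self, RingHom.id_apply]
  rw [Finset.sum_eq_single (Finsupp.single 0 N) h2]
  · rw [Finset.prod_eq_one, mul_one]
    · intro i _
      by_cases hi : i = 0
      · simp [hi]
      · simp [Finsupp.single_eq_of_ne hi]
  · intro hm
    rw [notMem_support_iff.mp hm, zero_mul]

theorem hasLeadingPower_of_euler {n N : ℕ} {p : MvPolynomial (Fin (n + 1)) ℂ}
    (h : virField (n + 1) 0 p = (N : MvPolynomial (Fin (n + 1)) ℂ) * p)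
    (h1 : aeval (fun i : Fin (n + 1) => if i = 0 then (1 : ℂ) else 0) p = 1) :
    HasLeadingPower p N := by
  intro m hm
  by_contra! hlt
  rw [mem_support_iff, coeff_sub, coeff_X_pow] at hm
  by_cases hmN : Finsupp.single 0 N = m
  · rw [if_pos hmN, ← hmN, coeff_single_eq_eval h, h1, sub_self] at hm
    exact hm rfl
  · rw [if_neg hmN, sub_zero] at hm
    exact hmN (eq_single_of_weight (weight_eq_of_euler h (mem_support_iff.mpr hm)) hlt).symm

end VectorFields

section Solution

/-- The times `t_i = b_i z_{2 i + 1}` of genus `g`. -/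
def scaledTime (g : ℕ) (b : ℕ → ℂ) : ℕ → MvPolynomial (Fin g) ℂ := fun i => C (b i) * z g (i + 1)

theorem virField_scaledTime (g : ℕ) (b : ℕ → ℂ) (k : ℕ) :
    virField g 0 (amTau (scaledTime g b) k)
      = (wt k : MvPolynomial (Fin g) ℂ) * amTau (scaledTime g b) k := by
  refine derivation_amTau_euler _ _ (fun i => ?_) k
  rw [scaledTime, derivation_C_mul_eq, virField_zero_z]
  simp only [map_add, map_mul, map_natCast, map_one, map_ofNat]
  ring

theorem hasLeadingPower_amTau (n : ℕ) (b : ℕ → ℂ) (hb : b 0 = 1) (k : ℕ) :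
    HasLeadingPower (amTau (scaledTime (n + 1) b) k) (wt k) := by
  refine hasLeadingPower_of_euler (virField_scaledTime _ b k) ?_
  have h : ∀ i, aeval (fun i : Fin (n + 1) => if i = 0 then (1 : ℂ) else 0)
      (scaledTime (n + 1) b i) = if i = 0 then 1 else 0 := by
    intro i
    rw [scaledTime, map_mul, aeval_C]
    by_cases hi : i < n + 1
    · rw [z_of_lt hi, aeval_X]
      by_cases h0 : i = 0
      · subst h0; simp [hb]
      · simp [h0, Fin.ext_iff]
    · rw [z_of_ge (by omega), map_zero, mul_zero, if_neg (by omega)]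
  rw [map_amTau, funext h, amTau]
  exact inv_mul_cancel₀ (leadConst_ne_zero k)

theorem pd_hInt {g : ℕ} (i : ℕ) (hi : i < g) (n : ℤ) :
    pd g (i + 1) (hInt (fun i => z g (i + 1)) n)
      = hInt (fun i => z g (i + 1)) (n - (2 * i + 1)) := by
  refine derivation_hInt_of_single _ _ i ?_ ?_ n
  · simp [pd_z, hi]
  · intro j hj
    rw [pd_z, if_neg (by omega)]

theorem virField_hInt {g : ℕ} (k : ℕ) (n : ℤ) (hn : n ≤ 2 * g) :
    virField g k (hInt (fun i => z g (i + 1)) n)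
      = ((n - 2 * k : ℤ) : MvPolynomial (Fin g) ℂ) * hInt (fun i => z g (i + 1)) (n - 2 * k) := by
  refine derivation_hInt_virasoro _ _ k g (fun i hi => virField_z_of_lt k i hi)
    (fun i hi => ?_) n hn
  rw [virField_z k i hi]
  simp only [map_add, map_mul, map_natCast, map_one, map_ofNat]

/-- The normalized staircase polynomial of size `g` solves the system of genus `g`. -/
theorem Hhat_amTau {g : ℕ} (hg : 1 ≤ g) :
    Hhat0 g (amTau (fun i => z g (i + 1)) g) = 0 ∧ Hhat2 g (amTau (fun i => z g (i + 1)) g) = 0 ∧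
      Hhat4 g (amTau (fun i => z g (i + 1)) g) = 0 := by
  have hneg := hInt_of_neg (fun i => z g (i + 1))
  have h1 : ∀ n, pd g 1 (hInt (fun i => z g (i + 1)) n) = hInt (fun i => z g (i + 1)) (n - 1) :=
    fun n => by simpa using pd_hInt 0 hg n
  have hS : amTau (fun i => z g (i + 1)) g
      = C (leadConst g)⁻¹ * hDet (hInt fun i => z g (i + 1)) (stair g) := rfl
  refine ⟨?_, ?_, ?_⟩
  · have h := virField_scaledTime g 1 g
    have e : scaledTime g 1 = fun i => z g (i + 1) := by funext i; simp [scaledTime]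
    rw [e, virField_apply] at h
    rw [Hhat0_eq]
    simp only [add_zero, Nat.sub_zero] at h
    rw [h, sub_eq_zero, ← map_natCast C (wt g)]
    congr 2
    have := two_mul_wt g
    have h2 : (2 : ℂ) * wt g = g * (g + 1) := by exact_mod_cast this
    linear_combination h2 / 2
  · have h := hDet_stair_virasoro_one (g := g) _ hneg (pd g 1) (virField g 1) h1
      (fun n hn => by simpa using virField_hInt 1 n hn.le)
    rw [Hhat2_eq, ← virField_apply, hS, derivation_C_mul_eq, derivation_C_mul_eq,
      derivation_C_mul_eq]
    have h2 : (C (1 / 2) : MvPolynomial (Fin g) ℂ) * 2 = 1 := by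
      rw [← map_ofNat C 2, ← C_mul]
      norm_num
    linear_combination C (leadConst g)⁻¹ * C (1 / 2) * h
      - C (leadConst g)⁻¹ * virField g 1 (hDet (hInt fun i => z g (i + 1)) (stair g)) * h2
  · rw [Hhat4_eq, ← virField_apply]
    -- In genus one `H_4` is zero, since `∂_3 = 0`.
    rcases hg.eq_or_lt with rfl | hg2
    · have e1 : pd 1 2 = 0 := by rw [pd, dif_neg (by omega)]
      rw [e1, virField_apply]
      simp
    · have h3 : ∀ n, pd g 2 (hInt (fun i => z g (i + 1)) n)
          = hInt (fun i => z g (i + 1)) (n - 3) := fun n => by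
        have := pd_hInt 1 hg2 n
        norm_num at this
        exact this
      have h := hDet_stair_virasoro_two (g := g) _ hneg (pd g 1) (pd g 2) (virField g 2) h1 h3
        (fun n hn => by
          have := virField_hInt 2 n hn.le
          norm_num at this
          simpa using this)
      rw [hS, derivation_C_mul_eq, derivation_C_mul_eq, derivation_C_mul_eq, ← mul_add, h,
        mul_zero]

end Solution

end AdlerMoser

/-! ### Universal Adler–Moser polynomials and changes of variables -/

namespace AdlerMoser
open Finset MvPolynomial

section Existence

/-- The scaling of the times for which the last time enters the normalized staircase polynomials
with coefficient one. -/
def timeScale : ℕ → ℂ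
  | 0 => 1
  | k + 1 => (lastCoeff k)⁻¹

theorem timeScale_ne_zero : ∀ i, timeScale i ≠ 0
  | 0 => one_ne_zero
  | k + 1 => inv_ne_zero (lastCoeff_ne_zero k)

/-- The normalized staircase polynomials in scaled times. -/
def universalTheta (k : ℕ) : MvPolynomial (Fin k) ℂ := amTau (scaledTime k timeScale) k

theorem rename_universalTheta {k l : ℕ} (f : Fin k → Fin l) (hf : ∀ i, (f i : ℕ) = i) :
    rename f (universalTheta k) = amTau (scaledTime l timeScale) k := by
  rw [universalTheta, map_amTau]
  refine amTau_congr k fun i hi => ?_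
  have h := hf ⟨i, hi⟩
  have hl : i < l := by have := (f ⟨i, hi⟩).2; simp only at h; omega
  rw [scaledTime, scaledTime, map_mul, rename_C, z_of_lt hi, z_of_lt hl, rename_X]
  congr 2
  exact Fin.ext h

theorem pderiv_scaledTime {g : ℕ} (b : ℕ → ℂ) (j : Fin g) (i : ℕ) :
    pderiv j (scaledTime g b i) = if i = j then C (b i) else 0 := by
  have h := pd_z (g := g) (j + 1) i
  rw [pd_of_lt j.2] at h
  rw [scaledTime, derivation_C_mul_eq, h]
  by_cases hij : i = j
  · simp [hij]
  · rw [if_neg (by omega), if_neg hij, mul_zero]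

/-- The times `x, u_1, u_2, …` of a sequence of polynomials in one variable. -/
def xTime (u : ℕ → ℂ) (i : ℕ) : Polynomial ℂ := if i = 0 then Polynomial.X else Polynomial.C (u i)

theorem derivative_xTime (u : ℕ → ℂ) :
    Polynomial.derivative' (xTime u 0) = 1 ∧
      ∀ i, i ≠ 0 → Polynomial.derivative' (xTime u i) = 0 :=
  ⟨by simp [xTime], fun i hi => by simp [xTime, hi]⟩

theorem IsAdlerMoserSequence.ne_zero {φ : ℕ → Polynomial ℂ} (hφ : IsAdlerMoserSequence φ) :
    ∀ n, φ n ≠ 0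
  | 0 => by rw [hφ.zero]; exact one_ne_zero
  | 1 => by rw [hφ.one]; exact Polynomial.X_ne_zero
  | n + 2 => by
    intro h
    have h1 := hφ.rec_eq n
    rw [h, Polynomial.derivative_zero, zero_mul, zero_mul, sub_zero] at h1
    have h2 : (2 * ((n : ℂ) + 1) + 1) ≠ 0 := by exact_mod_cast Nat.succ_ne_zero (2 * (n + 1))
    exact mul_ne_zero (Polynomial.C_ne_zero.mpr h2) (pow_ne_zero 2 (hφ.ne_zero (n + 1))) h1.symm

/-- Two consecutive terms determine the next one up to a multiple of the first of them, which is
absorbed by the last time. -/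
theorem IsAdlerMoserSequence.exists_next {φ : ℕ → Polynomial ℂ} (hφ : IsAdlerMoserSequence φ)
    (u : ℕ → ℂ) (k : ℕ) (h0 : φ k = amTau (xTime u) k) (h1 : φ (k + 1) = amTau (xTime u) (k + 1)) :
    ∃ a : ℂ, φ (k + 2) = amTau (xTime (Function.update u (k + 1) a)) (k + 2) := by
  have hne := hφ.ne_zero k
  have hw := amTau_wronskian Polynomial.derivative' (xTime u) (derivative_xTime u).1
    (derivative_xTime u).2 k
  rw [← h0, ← h1] at hw
  have hφw := hφ.rec_eq k
  have hw' : Polynomial.derivative (φ (k + 2) - amTau (xTime u) (k + 2)) * φ k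
      = (φ (k + 2) - amTau (xTime u) (k + 2)) * Polynomial.derivative (φ k) := by
    rw [Polynomial.derivative_sub]
    change Polynomial.derivative (amTau (xTime u) (k + 2)) * φ k
      - amTau (xTime u) (k + 2) * Polynomial.derivative (φ k) = Polynomial.C _ * _ at hw
    linear_combination hφw - hw
  have hlc : (φ k).leadingCoeff ≠ 0 := Polynomial.leadingCoeff_ne_zero.mpr hne
  have hc := eq_C_mul_of_wronskian_eq_zero hne hw' _ (div_mul_cancel₀ _ hlc).symm
  set c := (φ (k + 2) - amTau (xTime u) (k + 2)).coeff (φ k).natDegree / (φ k).leadingCoeff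
  refine ⟨u (k + 1) + c / lastCoeff k, ?_⟩
  have hup : xTime (Function.update u (k + 1) (u (k + 1) + c / lastCoeff k))
      = Function.update (xTime u) (k + 1) (Polynomial.C (u (k + 1) + c / lastCoeff k)) := by
    funext i
    by_cases hi : i = k + 1
    · subst hi; simp [xTime]
    · simp [xTime, hi]
  have hcc : Polynomial.C (lastCoeff k) * Polynomial.C (c / lastCoeff k) = Polynomial.C c := by
    rw [← Polynomial.C_mul, mul_div_cancel₀ _ (lastCoeff_ne_zero k)]
  rw [hup, amTau_update, ← h0, Polynomial.algebraMap_eq, xTime, if_neg (Nat.succ_ne_zero k),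
    Polynomial.C_add]
  linear_combination hc - φ k * hcc

/-- The times are chosen one after another, `U n` being the sequence after `n` choices. -/
theorem IsAdlerMoserSequence.exists_times {φ : ℕ → Polynomial ℂ} (hφ : IsAdlerMoserSequence φ) :
    ∃ u : ℕ → ℂ, ∀ k, φ k = amTau (xTime u) k := by
  choose! a ha using hφ.exists_next
  let U : ℕ → ℕ → ℂ := fun n => n.rec 0 fun k u => Function.update u (k + 1) (a u k)
  have hU : ∀ k, U (k + 1) = Function.update (U k) (k + 1) (a (U k) k) := fun k => rfl
  have hcongr : ∀ (u v : ℕ → ℂ) k, (∀ i < k, u i = v i) →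
      amTau (xTime u) k = amTau (xTime v) k := by
    intro u v k h
    refine amTau_congr k fun i hi => ?_
    rw [xTime, xTime, h i hi]
  have hstable : ∀ i n, i ≤ n → U n i = U i i := by
    intro i n hin
    induction n, hin using Nat.le_induction with
    | base => rfl
    | succ n hin ih => rw [hU, Function.update_of_ne (by omega), ih]
  have hmain : ∀ n, φ n = amTau (xTime (U n)) n ∧ φ (n + 1) = amTau (xTime (U n)) (n + 1) := by
    intro n
    induction n with
    | zero => exact ⟨by rw [hφ.zero, amTau_zero], by rw [hφ.one, amTau_one]; simp [xTime]⟩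
    | succ n ih =>
      refine ⟨?_, ?_⟩
      · rw [ih.2]
        refine hcongr _ _ _ fun i hi => ?_
        rw [hU, Function.update_of_ne (by omega)]
      · rw [hU]
        exact ha _ _ ih.1 ih.2
  refine ⟨fun i => U i i, fun k => ?_⟩
  rw [(hmain k).1]
  exact hcongr _ _ _ fun i hi => hstable i k hi.le

theorem isUniversalAdlerMoser_universalTheta : IsUniversalAdlerMoser universalTheta where
  zero := amTau_zero _
  one := by
    rw [universalTheta, amTau_one, scaledTime, z_of_lt one_pos]
    simp [timeScale]
  rec_eq n := by
    rw [rename_universalTheta (Fin.castAdd 2) fun i => rfl,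
      rename_universalTheta Fin.castSucc fun i => rfl]
    refine amTau_wronskian (pderiv 0) _ ?_ ?_ n
    · simp [pderiv_scaledTime, timeScale]
    · intro i hi
      simp [pderiv_scaledTime, hi]
  general φ hφ := by
    obtain ⟨u, hu⟩ := hφ.exists_times
    refine ⟨fun i => u (i - 1) / timeScale (i - 1), fun k => ?_⟩
    rw [hu k, specialize, universalTheta, map_amTau]
    refine amTau_congr k fun i hi => ?_
    rw [scaledTime, z_of_lt hi, map_mul, aeval_X, aeval_C, xTime, Polynomial.algebraMap_eq]
    by_cases h : i = 0
    · simp [h, timeScale]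
    · simp only [h, if_false, Nat.add_sub_cancel]
      rw [← Polynomial.C_mul, mul_div_cancel₀ _ (timeScale_ne_zero i)]
  leading n := hasLeadingPower_amTau n timeScale rfl (n + 1)
  leading_pderiv n := by
    have h : pderiv (Fin.last (n + 1)) (universalTheta (n + 2))
        = amTau (scaledTime (n + 2) timeScale) n := by
      have h1 : pderiv (Fin.last (n + 1)) (amTau (scaledTime (n + 2) timeScale) n) = 0 :=
        derivation_amTau_eq_zero _ _ _ fun i hi => by
          rw [pderiv_scaledTime, if_neg (by simp only [Fin.val_last]; omega)]
      have h2 : pderiv (Fin.last (n + 1)) (amTau (Function.update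
          (scaledTime (n + 2) timeScale) (n + 1) 0) (n + 2)) = 0 :=
        derivation_amTau_eq_zero _ _ _ fun i hi => by
          by_cases hin : i = n + 1
          · rw [hin, Function.update_self, map_zero]
          · rw [Function.update_of_ne hin, pderiv_scaledTime, if_neg (by simpa using hin)]
      have h3 : (C (lastCoeff n) : MvPolynomial (Fin (n + 2)) ℂ) * C (timeScale (n + 1)) = 1 := by
        rw [← C_mul, timeScale, mul_inv_cancel₀ (lastCoeff_ne_zero n),
          C_1]
      rw [universalTheta, amTau_update_zero, map_add, h2, zero_add, Derivation.leibniz, h1,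
        smul_zero, zero_add, MvPolynomial.algebraMap_eq, derivation_C_mul_eq, pderiv_scaledTime,
        if_pos (by simp), h3, smul_eq_mul, mul_one]
    rw [h]
    exact hasLeadingPower_amTau (n + 1) timeScale rfl n

end Existence

section ChangeOfVariables

/-- The chain rule. -/
theorem derivation_aeval {R : Type*} [CommRing R] [Algebra ℂ R] {k : ℕ} (δ : Derivation ℂ R R)
    (f : Fin k → R) (p : MvPolynomial (Fin k) ℂ) :
    δ (aeval f p) = ∑ i, aeval f (pderiv i p) * δ (f i) := by
  induction p using MvPolynomial.induction_on with
  | C a => simp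
  | add p q hp hq => simp only [map_add, hp, hq, add_mul, Finset.sum_add_distrib]
  | mul_X p j hp =>
    simp only [map_mul, aeval_X, Derivation.leibniz, hp, pderiv_X, smul_eq_mul, map_add, add_mul,
      Finset.sum_add_distrib, Finset.mul_sum]
    rw [Finset.sum_eq_single (f := fun i => aeval f p * aeval f (Pi.single (M := fun _ => _) i 1 j)
      * δ (f i)) j]
    · simp [mul_assoc]
    · intro i _ hi
      simp [hi.symm]
    · simp

theorem aeval_eq_self {g : ℕ} (f : Fin g → MvPolynomial (Fin g) ℂ) (j : Fin g)
    (hf : ∀ i, i ≠ j → f i = X i) {p : MvPolynomial (Fin g) ℂ} (hp : pderiv j p = 0) :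
    aeval f p = p := by
  have h := notMem_vars_of_pderiv_eq_zero hp
  conv_rhs => rw [← aeval_X_left_apply p]
  exact eval₂Hom_congr' rfl (fun i hi _ => hf i fun hij => h (hij ▸ hi)) rfl

/-- The times of genus `n + 1` and the first `k` new variables `σ`, in which the first `k`
universal polynomials become the normalized staircase polynomials. -/
structure IsPartialChange (θ : (k : ℕ) → MvPolynomial (Fin k) ℂ) (n k : ℕ)
    (σ : ℕ → MvPolynomial (Fin (n + 1)) ℂ) : Prop where
  zero : σ 0 = X 0
  triangular : ∀ i (hi : i < n + 1), 0 < i → i < k → ∃ (b : ℂ) (h : MvPolynomial (Fin (n + 1)) ℂ),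
    b ≠ 0 ∧ (∀ j : Fin (n + 1), (j : ℕ) = 0 ∨ i ≤ j → pderiv j h = 0) ∧
      σ i = C b * X ⟨i, hi⟩ + h
  aeval_eq : ∀ j ≤ k, aeval (fun i : Fin j => σ i) (θ j) = amTau (fun i => z (n + 1) (i + 1)) j

/-- The construction of the next variable. With the coordinate `z_e`, where `e = m + 1`, in place of
the new variable, the polynomial `θ_{m + 2}` differs from the staircase polynomial `S_{m + 2}` by
`c S_m`, and `c` turns out to be `(1 - β) z_e + c₀` with `c₀` a polynomial in the coordinates
strictly between the first and the new one. As `z_e` enters `S_{m + 2}` through `β z_e S_m`, the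
difference vanishes after the substitution of `β z_e - c₀` for `z_e` in `θ_{m + 2}`. -/
theorem IsPartialChange.exists_succ {θ : (k : ℕ) → MvPolynomial (Fin k) ℂ}
    (hθ : IsUniversalAdlerMoser θ) {n m : ℕ} (hm : m + 1 < n + 1)
    {σ : ℕ → MvPolynomial (Fin (n + 1)) ℂ} (hσ : IsPartialChange θ n (m + 1) σ) :
    ∃ σ', IsPartialChange θ n (m + 2) σ' := by
  set T : ℕ → MvPolynomial (Fin (n + 1)) ℂ := fun i => z (n + 1) (i + 1) with hT
  set e : Fin (n + 1) := ⟨m + 1, hm⟩ with he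
  set β := lastCoeff m with hβ
  have hTs : T = scaledTime (n + 1) 1 := by funext i; simp [hT, scaledTime]
  have hTd : ∀ (j : Fin (n + 1)) i, pderiv j (T i) = if i = j then 1 else 0 := by
    intro j i
    rw [hTs, pderiv_scaledTime]
    simp
  have hTe : T (m + 1) = X e := z_of_lt hm
  have hσ0 : ∀ i, i ≠ 0 → i < m + 1 → pderiv 0 (σ i) = 0 := by
    intro i hi him
    obtain ⟨b, h, -, hh, hσi⟩ := hσ.triangular i (by omega) (by omega) him
    rw [hσi, map_add, hh 0 (Or.inl rfl), derivation_C_mul_eq,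
      pderiv_X_of_ne (by simpa [Fin.ext_iff] using hi), mul_zero, zero_add]
  have hσj : ∀ (j : Fin (n + 1)) i, i < m + 1 → m + 1 ≤ j → pderiv j (σ i) = 0 := by
    intro j i him hj
    rcases Nat.eq_zero_or_pos i with rfl | hi
    · rw [hσ.zero, pderiv_X_of_ne]
      intro h
      have := congrArg Fin.val h
      simp only [Fin.val_zero] at this
      omega
    · obtain ⟨b, h, -, hh, hσi⟩ := hσ.triangular i (by omega) hi him
      rw [hσi, map_add, hh j (Or.inr (by omega)), derivation_C_mul_eq,
        pderiv_X_of_ne (by simp only [ne_eq, Fin.ext_iff]; omega), mul_zero, zero_add]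
  -- `F` is the universal polynomial with the old coordinate in place of the new variable.
  let s : Fin (m + 2) → MvPolynomial (Fin (n + 1)) ℂ :=
    fun i => if (i : ℕ) = m + 1 then X e else σ i
  have hslt : ∀ i : Fin (m + 2), (i : ℕ) < m + 1 → s i = σ i := fun i hi => if_neg (by omega)
  have hslast : s (Fin.last (m + 1)) = X e := if_pos (by simp)
  have hs0 : s 0 = X 0 := by rw [hslt 0 (by simp)]; exact hσ.zero
  have hs0' : ∀ i, i ≠ 0 → pderiv 0 (s i) = 0 := by
    intro i hi
    have hi' : (i : ℕ) ≠ 0 := fun h => hi (Fin.ext h)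
    by_cases him : (i : ℕ) < m + 1
    · rw [hslt i him]
      exact hσ0 i hi' him
    · have : i = Fin.last (m + 1) := Fin.ext (by simp only [Fin.val_last]; omega)
      rw [this, hslast, pderiv_X_of_ne (by simp [he, Fin.ext_iff])]
  set F := aeval s (θ (m + 2)) with hF
  have hSm : ∀ j ≤ m + 1, ∀ f : Fin j → Fin (m + 2), (∀ i, (f i : ℕ) = i) →
      aeval s (rename f (θ j)) = amTau T j := by
    intro j hj f hf
    rw [aeval_rename, ← hσ.aeval_eq j hj]
    congr 2
    funext i
    rw [Function.comp, hslt _ (by rw [hf]; omega), hf]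
  have hchain0 : ∀ q : MvPolynomial (Fin (m + 2)) ℂ,
      pderiv 0 (aeval s q) = aeval s (pderiv 0 q) := by
    intro q
    rw [derivation_aeval, Finset.sum_eq_single 0]
    · rw [hs0, pderiv_X_self, mul_one]
    · intro i _ hi
      rw [hs0' i hi, mul_zero]
    · simp
  have hW1 := congrArg (aeval s) (hθ.rec_eq m)
  rw [map_sub, map_mul, map_mul, map_mul, map_pow, ← hchain0, ← hchain0,
    hSm m (by omega) _ fun i => rfl, hSm (m + 1) le_rfl _ fun i => rfl, ← hF, aeval_C] at hW1
  have hW2 := amTau_wronskian (pderiv (0 : Fin (n + 1))) T (by simp [hTd])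
    (fun i hi => by simp [hTd, hi]) m
  have hlead : HasLeadingPower (amTau T m) (wt m) := by
    rw [hTs]
    exact hasLeadingPower_amTau n 1 rfl m
  have hSne : amTau T m ≠ 0 := by
    intro h0
    have := hlead.monic.1.ne_zero
    rw [h0, map_zero] at this
    exact this rfl
  obtain ⟨c, hc0, hc⟩ := exists_eq_mul_of_wronskian_eq_zero (p := F - amTau T (m + 2)) hlead (by
    rw [map_sub]
    linear_combination hW1 - hW2)
  have hSd : ∀ j : Fin (n + 1), m ≤ j → pderiv j (amTau T m) = 0 := fun j hj =>
    derivation_amTau_eq_zero _ _ _ fun i hi => by rw [hTd, if_neg (by omega)]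
  -- The factor does not depend on the coordinates that come after the new one.
  have hcj : ∀ j : Fin (n + 1), m + 1 < j → pderiv j c = 0 := by
    intro j hj
    have h1 : pderiv j F = 0 := by
      rw [hF, derivation_aeval]
      refine Finset.sum_eq_zero fun i _ => ?_
      by_cases him : (i : ℕ) < m + 1
      · rw [hslt i him, hσj j i him hj.le, mul_zero]
      · have : i = Fin.last (m + 1) := Fin.ext (by simp only [Fin.val_last]; omega)
        rw [this, hslast, pderiv_X_of_ne, mul_zero]
        simp only [he, ne_eq, Fin.ext_iff]
        omega
    have h2 : pderiv j (amTau T (m + 2)) = 0 :=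
      derivation_amTau_eq_zero _ _ _ fun i hi => by rw [hTd, if_neg (by omega)]
    have h3 := congrArg (pderiv j) hc
    rw [map_sub, h1, h2, sub_zero, Derivation.leibniz, hSd j (by omega), smul_zero, zero_add,
      smul_eq_mul] at h3
    exact (mul_eq_zero.mp h3.symm).resolve_left hSne
  -- Both leading powers are known, which determines the derivative of the factor.
  have hce : pderiv e c = C (1 - β) := by
    have h1 : pderiv e F = aeval s (pderiv (Fin.last (m + 1)) (θ (m + 2))) := by
      rw [hF, derivation_aeval, Finset.sum_eq_single (Fin.last (m + 1))]
      · rw [hslast, pderiv_X_self, mul_one]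
      · intro i _ hi
        have him : (i : ℕ) < m + 1 := Fin.val_lt_last hi
        rw [hslt i him, hσj e i him le_rfl, mul_zero]
      · simp
    have h2 : pderiv e (amTau T (m + 2)) = C β * amTau T m := by
      rw [amTau_update_zero, map_add, derivation_amTau_eq_zero _ (Function.update T (m + 1) 0),
        zero_add, Derivation.leibniz, hSd e (by simp [he]), smul_zero, zero_add,
        MvPolynomial.algebraMap_eq, derivation_C_mul_eq, hTd, if_pos rfl, mul_one, smul_eq_mul,
        mul_comm]
      intro i hi
      by_cases him : i = m + 1
      · rw [him, Function.update_self, map_zero]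
      · rw [Function.update_of_ne him, hTd, if_neg (by simpa [he] using him)]
    have h3 := congrArg (pderiv e) hc
    rw [map_sub, h1, h2, Derivation.leibniz, hSd e (by simp [he]), smul_zero, zero_add,
      smul_eq_mul] at h3
    have h4 : HasLeadingPower ((pderiv e c + C β) * amTau T m) (wt m) := by
      have h5 := (hθ.leading_pderiv m).aeval s hs0 hs0'
      have h6 : (pderiv e c + C β) * amTau T m
          = aeval s (pderiv (Fin.last (m + 1)) (θ (m + 2))) := by linear_combination -h3
      rw [h6]
      exact h5
    have h7 := eq_one_of_hasLeadingPower_mul (by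
      rw [map_add, pderiv_pderiv_comm, hc0, map_zero, pderiv_C, add_zero]) hlead h4
    rw [C_sub, C_1, ← h7]
    ring
  obtain ⟨c₀, hc₀⟩ : ∃ c₀, c = c₀ + C (1 - β) * X e := ⟨c - C (1 - β) * X e, by ring⟩
  have hc₀d : ∀ j : Fin (n + 1), (j : ℕ) = 0 ∨ m + 1 ≤ j → pderiv j c₀ = 0 := by
    intro j hj
    have h : pderiv j c₀ = pderiv j c - C (1 - β) * pderiv j (X e) := by
      rw [hc₀, map_add, derivation_C_mul_eq]
      ring
    rw [h]
    by_cases hje : j = e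
    · rw [hje, hce, pderiv_X_self, mul_one, sub_self]
    · rw [pderiv_X_of_ne (Ne.symm hje), mul_zero, sub_zero]
      rcases hj with hj | hj
      · have : j = 0 := Fin.ext hj
        rw [this, hc0]
      · refine hcj j (lt_of_le_of_ne hj fun h => hje (Fin.ext h.symm))
  set w := C β * X e - c₀ with hw
  refine ⟨Function.update σ (m + 1) w, ?_, ?_, ?_⟩
  · rw [Function.update_of_ne (Nat.succ_ne_zero m).symm, hσ.zero]
  · intro i hi hi0 him
    by_cases hie : i = m + 1
    · subst hie
      refine ⟨β, -c₀, lastCoeff_ne_zero m, fun j hj => ?_, ?_⟩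
      · rw [map_neg, hc₀d j hj, neg_zero]
      · rw [Function.update_self, hw, sub_eq_add_neg]
    · rw [Function.update_of_ne hie]
      exact hσ.triangular i hi hi0 (by omega)
  · intro j hj
    rcases hj.lt_or_eq with hj | rfl
    · rw [← hσ.aeval_eq j (by omega)]
      congr 2
      funext i
      rw [Function.update_of_ne (by omega)]
    · -- Substitute `w` for the old coordinate in `F = S_{m+2} + c S_m`.
      let f : Fin (n + 1) → MvPolynomial (Fin (n + 1)) ℂ := fun i => if i = e then w else X i
      have hf : ∀ i, i ≠ e → f i = X i := fun i hi => if_neg hi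
      have hfe : f e = w := if_pos rfl
      have h1 : aeval f F
          = aeval (fun i : Fin (m + 2) => Function.update σ (m + 1) w i) (θ (m + 2)) := by
        rw [hF, ← AlgHom.comp_apply, comp_aeval]
        congr 2
        funext i
        by_cases him : (i : ℕ) < m + 1
        · rw [hslt i him, Function.update_of_ne (by omega)]
          exact aeval_eq_self f e hf (hσj e i him le_rfl)
        · have hi : i = Fin.last (m + 1) := Fin.ext (by simp only [Fin.val_last]; omega)
          rw [hi, hslast, aeval_X, hfe, Fin.val_last, Function.update_self]
      have h2 : (fun i => aeval f (T i)) = Function.update T (m + 1) w := by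
        funext i
        by_cases hi : i = m + 1
        · rw [hi, hTe, aeval_X, hfe, Function.update_self]
        · rw [Function.update_of_ne hi]
          exact aeval_eq_self f e hf (by rw [hTd, if_neg (by simpa [he] using hi)])
      have h3 := congrArg (aeval f) hc
      rw [map_sub, h1, map_amTau, h2, amTau_update, map_mul,
        aeval_eq_self f e hf (hSd e (by simp [he])), hc₀, map_add,
        aeval_eq_self f e hf (hc₀d e (Or.inr le_rfl)), map_mul, aeval_X, hfe, aeval_C, hTe,
        MvPolynomial.algebraMap_eq] at h3
      have hC : (C (1 - β) : MvPolynomial (Fin (n + 1)) ℂ) = 1 - C β := by rw [C_sub, C_1]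
      rw [hC] at h3
      linear_combination h3 + amTau T m * hw

theorem IsUniversalAdlerMoser.exists_isPartialChange {θ : (k : ℕ) → MvPolynomial (Fin k) ℂ}
    (hθ : IsUniversalAdlerMoser θ) (n : ℕ) : ∀ k ≤ n, ∃ σ, IsPartialChange θ n (k + 1) σ
  | 0, _ => by
    refine ⟨fun _ => X 0, rfl, fun i _ h1 h2 => by omega, fun j hj => ?_⟩
    rcases Nat.le_one_iff_eq_zero_or_eq_one.mp hj with rfl | rfl
    · rw [hθ.zero, map_one, amTau_zero]
    · rw [hθ.one, aeval_X, amTau_one, z_of_lt n.succ_pos]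
      rfl
  | k + 1, hk => by
    obtain ⟨σ, hσ⟩ := hθ.exists_isPartialChange n k (by omega)
    exact hσ.exists_succ hθ (by omega)

end ChangeOfVariables
end AdlerMoser

/-! ### Uniqueness of the solution of the system -/

namespace AdlerMoser
open Finset MvPolynomial

section Uniqueness

variable {g : ℕ}

theorem homogeneousComponent_X_mul_pderiv (i j : Fin g) (d : ℕ) (p : MvPolynomial (Fin g) ℂ) :
    homogeneousComponent d (X i * pderiv j p) = X i * pderiv j (homogeneousComponent d p) := by
  ext m
  rw [coeff_homogeneousComponent, coeff_X_mul', coeff_X_mul', coeff_pderiv, coeff_pderiv,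
    coeff_homogeneousComponent]
  by_cases hi : i ∈ m.support
  · have hdeg : (m - Finsupp.single i 1 + Finsupp.single j 1).degree = m.degree := by
      have h1 : m - Finsupp.single i 1 + Finsupp.single i 1 = m :=
        tsub_add_cancel_of_le (Finsupp.single_le_iff.mpr
          (Nat.one_le_iff_ne_zero.mpr (Finsupp.mem_support_iff.mp hi)))
      conv_rhs => rw [← h1]
      simp
    rw [if_pos hi, if_pos hi, hdeg]
    split_ifs <;> simp
  · simp [hi]

theorem virField_homogeneousComponent (k d : ℕ) (p : MvPolynomial (Fin g) ℂ) :
    homogeneousComponent d (virField g k p) = virField g k (homogeneousComponent d p) := by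
  rw [virField_apply_fin, virField_apply_fin, map_sum]
  refine Finset.sum_congr rfl fun i _ => ?_
  rw [homogeneousComponent_C_mul]
  congr 1
  by_cases h : (i : ℕ) + k < g
  · rw [z_of_lt i.2, show (i : ℕ) + 1 + k = i + k + 1 by omega, pd_of_lt h,
      homogeneousComponent_X_mul_pderiv]
  · have h : pd g ((i : ℕ) + 1 + k) = 0 := by rw [pd, dif_neg (by omega)]
    rw [h, Derivation.zero_apply, Derivation.zero_apply, mul_zero, map_zero]

theorem homogeneousComponent_totalDegree_pd_pd (s t : ℕ) (p : MvPolynomial (Fin g) ℂ) :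
    homogeneousComponent p.totalDegree (pd g s (pd g t p)) = 0 := by
  by_cases hs : 1 ≤ s ∧ s ≤ g
  · by_cases ht : 1 ≤ t ∧ t ≤ g
    · obtain ⟨i, rfl⟩ : ∃ i, s = i + 1 := ⟨s - 1, by omega⟩
      obtain ⟨j, rfl⟩ : ∃ j, t = j + 1 := ⟨t - 1, by omega⟩
      rw [pd_of_lt (by omega), pd_of_lt (by omega)]
      ext m
      rw [coeff_homogeneousComponent, coeff_zero]
      split_ifs with hm
      · rw [coeff_pderiv, coeff_pderiv, coeff_eq_zero_of_totalDegree_lt, zero_mul, zero_mul]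
        change _ < Finsupp.degree _
        simp only [map_add, Finsupp.degree_single, hm]
        omega
      · rfl
    · have h : pd g t = 0 := by rw [pd, dif_neg ht]
      rw [h, Derivation.zero_apply, map_zero, map_zero]
  · have h : pd g s = 0 := by rw [pd, dif_neg hs]
    rw [h, Derivation.zero_apply, map_zero]

theorem virField_eq_zero {p : MvPolynomial (Fin g) ℂ} (h1 : virField g 1 p = 0)
    (h2 : virField g 2 p = 0) : ∀ k, virField g (k + 1) p = 0
  | 0 => h1
  | 1 => h2
  | k + 2 => by
    have ih := virField_eq_zero h1 h2 (k + 1)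
    have h := congrArg (fun D => D p) (virField_commutator (g := g) (k + 2))
    simp only [Derivation.commutator_apply, Derivation.smul_apply, smul_eq_mul] at h
    rw [ih, h1, map_zero, map_zero, sub_zero] at h
    have hc : (C (2 - 2 * ((k + 2 : ℕ) : ℂ)) : MvPolynomial (Fin g) ℂ) ≠ 0 := by
      rw [Ne, C_eq_zero, show (2 : ℂ) - 2 * ((k + 2 : ℕ) : ℂ) = -(2 * ((k + 1 : ℕ) : ℂ)) by
        push_cast; ring, neg_eq_zero]
      exact mul_ne_zero two_ne_zero (Nat.cast_ne_zero.mpr k.succ_ne_zero)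
    exact (mul_eq_zero.mp h.symm).resolve_left hc

/-- The vector fields `virField g k` with `k ≥ 1` form a triangular system in the derivatives by all
coordinates but the first, with the first coordinate on the diagonal. -/
theorem pderiv_eq_zero_of_virField {n : ℕ} {p : MvPolynomial (Fin (n + 1)) ℂ}
    (h : ∀ k, virField (n + 1) (k + 1) p = 0) :
    ∀ l j : ℕ, (hj : j < n + 1) → 0 < j → n < j + l → pderiv ⟨j, hj⟩ p = 0 := by
  intro l
  induction l with
  | zero =>
    intro j hj hj0 hjl
    omega
  | succ l ih =>
    intro j hj hj0 hjl
    have h1 := h (j - 1)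
    rw [virField_apply_fin, Finset.sum_eq_single 0] at h1
    · rw [show ((0 : Fin (n + 1)) : ℕ) + 1 + (j - 1 + 1) = j + 1 by
          simp only [Fin.val_zero]; omega, pd_of_lt hj,
        show z (n + 1) ((0 : Fin (n + 1)) + 1) = X 0 from z_of_lt (Nat.succ_pos n)] at h1
      have h2 : (C (2 * (((0 : Fin (n + 1)) : ℕ) : ℂ) + 1) : MvPolynomial (Fin (n + 1)) ℂ) ≠ 0 := by
        simp
      exact (mul_eq_zero.mp ((mul_eq_zero.mp h1).resolve_left h2)).resolve_left (X_ne_zero 0)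
    · intro i _ hi
      have hi' : 0 < (i : ℕ) := Nat.pos_of_ne_zero fun h => hi (Fin.ext h)
      by_cases hij : (i : ℕ) + j < n + 1
      · rw [show (i : ℕ) + 1 + (j - 1 + 1) = i + j + 1 by omega, pd_of_lt hij,
          ih (i + j) hij (by omega) (by omega), mul_zero, mul_zero]
      · have h0 : pd (n + 1) ((i : ℕ) + 1 + (j - 1 + 1)) = 0 := by rw [pd, dif_neg (by omega)]
        rw [h0, Derivation.zero_apply, mul_zero, mul_zero]
    · simp

/-- A nonzero solution of the system contains the power of the first variable: its component of top
degree is annihilated by the vector fields, and so depends on the first variable only. -/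
theorem eq_zero_of_Hhat {n : ℕ} {ψ : MvPolynomial (Fin (n + 1)) ℂ}
    (h0 : Hhat0 (n + 1) ψ = 0) (h2 : Hhat2 (n + 1) ψ = 0) (h4 : Hhat4 (n + 1) ψ = 0)
    (hc : coeff (Finsupp.single 0 (wt (n + 1))) ψ = 0) : ψ = 0 := by
  by_contra hne
  set d := ψ.totalDegree with hd
  set φ := homogeneousComponent d ψ with hφ
  have hφ1 : virField (n + 1) 1 φ = 0 := by
    rw [Hhat2_eq, ← virField_apply] at h2
    have h := congrArg (homogeneousComponent d) h2
    rwa [map_add, homogeneousComponent_C_mul, homogeneousComponent_totalDegree_pd_pd, mul_zero,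
      zero_add, virField_homogeneousComponent, map_zero] at h
  have hφ2 : virField (n + 1) 2 φ = 0 := by
    rw [Hhat4_eq, ← virField_apply] at h4
    have h := congrArg (homogeneousComponent d) h4
    rwa [map_add, homogeneousComponent_totalDegree_pd_pd, zero_add,
      virField_homogeneousComponent, map_zero] at h
  have hp := pderiv_eq_zero_of_virField (virField_eq_zero hφ1 hφ2)
  obtain ⟨m, hm, hmd⟩ := Finset.exists_mem_eq_sup _ (support_nonempty.mpr hne)
    fun m => m.sum fun _ e => e
  have hdeg : m.degree = d := hmd.symm
  have hmφ : m ∈ φ.support := by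
    rw [mem_support_iff, hφ, coeff_homogeneousComponent, if_pos hdeg]
    exact mem_support_iff.mp hm
  have heul : virField (n + 1) 0 ψ = (wt (n + 1) : MvPolynomial (Fin (n + 1)) ℂ) * ψ := by
    rw [Hhat0_eq, sub_eq_zero] at h0
    rw [virField_apply]
    simp only [add_zero, Nat.sub_zero]
    rw [h0, ← map_natCast C (wt (n + 1))]
    congr 2
    have h : (2 : ℂ) * wt (n + 1) = ((n + 1 : ℕ) : ℂ) * (((n + 1 : ℕ) : ℂ) + 1) := by
      exact_mod_cast two_mul_wt (n + 1)
    linear_combination -h / 2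
  have hw := weight_eq_of_euler heul hm
  have hms : m = Finsupp.single 0 (wt (n + 1)) := by
    refine eq_single_of_weight hw ?_
    rw [← hw, Fin.sum_univ_succ, Finset.sum_eq_zero fun i _ => by
      rw [eq_zero_of_pderiv_eq_zero (hp (n + 1) _ i.succ.2 (by simp) (by omega)) hmφ, mul_zero]]
    simp
  rw [hms, mem_support_iff] at hm
  exact hm hc

theorem Hhat_iff (n : ℕ) (ψ : MvPolynomial (Fin (n + 1)) ℂ) :
    (Hhat0 (n + 1) ψ = 0 ∧ Hhat2 (n + 1) ψ = 0 ∧ Hhat4 (n + 1) ψ = 0) ↔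
      ∃ c : ℂ, ψ = C c * amTau (fun i => z (n + 1) (i + 1)) (n + 1) := by
  set S := amTau (fun i => z (n + 1) (i + 1)) (n + 1) with hS
  obtain ⟨hS0, hS2, hS4⟩ := Hhat_amTau (g := n + 1) (by omega)
  rw [← hS] at hS0 hS2 hS4
  have lin : ∀ (c : ℂ) (p : MvPolynomial (Fin (n + 1)) ℂ),
      Hhat0 (n + 1) (p + C c * S) = Hhat0 (n + 1) p ∧
      Hhat2 (n + 1) (p + C c * S) = Hhat2 (n + 1) p ∧
      Hhat4 (n + 1) (p + C c * S) = Hhat4 (n + 1) p := by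
    intro c p
    rw [Hhat0_eq] at hS0
    rw [Hhat2_eq, ← virField_apply] at hS2
    rw [Hhat4_eq, ← virField_apply] at hS4
    refine ⟨?_, ?_, ?_⟩
    · rw [Hhat0_eq, Hhat0_eq]
      have h := virField_apply (g := n + 1) 0
      simp only [add_zero, Nat.sub_zero] at h
      rw [← h] at hS0 ⊢
      rw [← h, map_add, derivation_C_mul_eq]
      linear_combination C c * hS0
    · rw [Hhat2_eq, Hhat2_eq, ← virField_apply, ← virField_apply]
      simp only [map_add, derivation_C_mul_eq]
      linear_combination C c * hS2
    · rw [Hhat4_eq, Hhat4_eq, ← virField_apply, ← virField_apply]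
      simp only [map_add, derivation_C_mul_eq]
      linear_combination C c * hS4
  constructor
  · rintro ⟨h0, h2, h4⟩
    set c := coeff (Finsupp.single 0 (wt (n + 1))) ψ with hc
    refine ⟨c, ?_⟩
    obtain ⟨l0, l2, l4⟩ := lin (-c) ψ
    have hlead : coeff (Finsupp.single 0 (wt (n + 1))) S = 1 := by
      have h := hasLeadingPower_amTau n 1 rfl (n + 1)
      have e : scaledTime (n + 1) 1 = fun i => z (n + 1) (i + 1) := by funext i; simp [scaledTime]
      rw [e, ← hS] at h
      have h' : coeff (Finsupp.single 0 (wt (n + 1))) (S - X 0 ^ wt (n + 1)) = 0 := by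
        by_contra hne
        have := h _ (mem_support_iff.mpr hne)
        simp at this
      rw [coeff_sub, coeff_X_pow, if_pos rfl] at h'
      exact sub_eq_zero.mp h'
    have h := eq_zero_of_Hhat (l0.trans h0) (l2.trans h2) (l4.trans h4) (by
      rw [coeff_add, coeff_C_mul, hlead, ← hc]
      ring)
    rw [C_neg] at h
    linear_combination h
  · rintro ⟨c, rfl⟩
    obtain ⟨l0, l2, l4⟩ := lin c 0
    rw [zero_add] at l0 l2 l4
    rw [l0, l2, l4]
    simp [Hhat0_eq, Hhat2_eq, Hhat4_eq]

end Uniqueness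
end AdlerMoser

end

theorem mainTheorem4 :
    (∃ θ : (k : ℕ) → MvPolynomial (Fin k) ℂ, AdlerMoser.IsUniversalAdlerMoser θ) ∧
    ∀ θ : (k : ℕ) → MvPolynomial (Fin k) ℂ, AdlerMoser.IsUniversalAdlerMoser θ →
      ∀ g : ℕ, 1 ≤ g →
        ∃ τ : Fin g → MvPolynomial (Fin g) ℂ, AdlerMoser.IsChangeOfVariables τ ∧
          ∀ ψ : MvPolynomial (Fin g) ℂ,
            (AdlerMoser.Hhat0 g ψ = 0 ∧ AdlerMoser.Hhat2 g ψ = 0 ∧ AdlerMoser.Hhat4 g ψ = 0) ↔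
              ∃ c : ℂ, ψ = MvPolynomial.C c * MvPolynomial.aeval τ (θ g) := by
  refine ⟨⟨_, AdlerMoser.isUniversalAdlerMoser_universalTheta⟩, fun θ hθ g hg => ?_⟩
  obtain ⟨n, rfl⟩ : ∃ n, g = n + 1 := ⟨g - 1, by omega⟩
  obtain ⟨σ, hσ⟩ := hθ.exists_isPartialChange n n le_rfl
  refine ⟨fun i => σ i, ⟨fun i hi => ?_, fun i hi => ?_⟩, fun ψ => ?_⟩
  · have h : i = 0 := Fin.ext hi
    subst h
    exact hσ.zero
  · obtain ⟨b, h, hb, hh, he⟩ := hσ.triangular i i.2 hi i.2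
    refine ⟨b, h, hb, fun j hj => ?_, he⟩
    by_contra hne
    refine AdlerMoser.notMem_vars_of_pderiv_eq_zero (hh j ?_) hj
    omega
  · rw [AdlerMoser.Hhat_iff, hσ.aeval_eq (n + 1) le_rfl]
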